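/- Let $T>0$, let $a\in L^\infty([0,T])$ satisfy $a\ge 0$ a.e. and $a\not\equiv 0$, let $k\ge 1$ be an integer, and put $\mathbb T=\mathbb R/T\mathbb Z$, $\sigma_k=(2\pi k/T)^2$, $$\varphi_k(t)=\sqrt{\tfrac2T}\cos\!\big(\tfrac{2\pi k}{T}t\big),\qquad \phi_k(t)=\sqrt{\tfrac2T}\sin\!\big(\tfrac{2\pi k}{T}t\big).$$ Let $H^2(\mathbb T)=\{u\in H^2([0,T]): u(0)=u(T),\ u'(0)=u'(T)\}$ with $(u,v)_{H^2}=\sum_{\alpha=0}^2\int_0^T D^\alpha u\,D^\alpha v\,dt$, let $L^2(\mathbb T)$ carry $(u,v)_{L^2}=\int_0^T uv\,dt$, and let $$\mathfrak F:\mathbb R\times H^2(\mathbb T)\to L^2(\mathbb T),\qquad \mathfrak F(\lambda,u)=u''+\lambda u+a(t)u^3,\qquad \mathfrak L(\lambda)u=u''+\lambda u .$$ Let $N_k=N[\mathfrak L(\sigma_k)]\subset H^2(\mathbb T)$ be the null space, $N_k^\perp$ its orthogonal complement in $H^2(\mathbb T)$, $Q_kv=(v,\varphi_k)_{L^2}\varphi_k+(v,\phi_k)_{L^2}\phi_k$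 on $L^2(\mathbb T)$, and $L:\mathbb R^2\to N_k$, $L(x_1,x_2)=x_1\varphi_k+x_2\phi_k$. Call $(I,\mathcal N,\psi)$ a reduction at $(\sigma_k,0)$ if $I\ni\sigma_k$ is open in $\mathbb R$, $\mathcal N\ni0$ is open in $N_k$, and $\psi:I\times\mathcal N\to N_k^\perp$ is a $C^\infty$ map with $\psi(\sigma_k,0)=0$ and $$(\mathrm{Id}-Q_k)\,\mathfrak F(\lambda,x+\psi(\lambda,x))=0\qquad\text{for all }(\lambda,x)\in I\times\mathcal N.$$ A reduction exists, and it can be chosen so that, for some neighborhood $\mathcal O$ of $(\sigma_k,0)$ in $\mathbb R\times H^2(\mathbb T)$: whenever $x\in N_k$, $y\in N_k^\perp$, $(\lambda,x+y)\in\mathcal O$ and $(\mathrm{Id}-Q_k)\mathfrak F(\lambda,x+y)=0$, one has $(\lambda,x)\in I\times\mathcal N$ and $y=\psi(\lambda,x)$. For every reduction, let $\Omega=L^{-1}(\mathcal N)$ and define the reduced map $(h_1,h_2):I\times\Omega\to\mathbb R^2$ by $$h_1=\big(Q_k\mathfrak F(\lambda,L(x_1,x_2)+\psi(\lambda,L(x_1,x_2))),\varphi_k\big)_{L^2},\qquad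 h_2=\big(Q_k\mathfrak F(\lambda,L(x_1,x_2)+\psi(\lambda,L(x_1,x_2))),\phi_k\big)_{L^2}.$$ Then $h_1,h_2$ are $C^\infty$ on $I\times\Omega$, and their Taylor expansions at $(\lambda,x_1,x_2)=(\sigma_k,0,0)$ are $$h_1=(\lambda-\sigma_k)x_1+a_kx_1^3+3b_kx_1^2x_2+3c_kx_1x_2^2+d_kx_2^3+R_1(\lambda,x_1,x_2),$$ $$h_2=(\lambda-\sigma_k)x_2+b_kx_1^3+3c_kx_1^2x_2+3d_kx_1x_2^2+e_kx_2^3+R_2(\lambda,x_1,x_2),$$ where $$a_k=(a\varphi_k^3,\varphi_k)_{L^2},\quad b_k=(a\varphi_k^2\phi_k,\varphi_k)_{L^2}=(a\varphi_k^3,\phi_k)_{L^2},\quad c_k=(a\varphi_k\phi_k^2,\varphi_k)_{L^2}=(a\varphi_k^2\phi_k,\phi_k)_{L^2},$$ $$d_k=(a\phi_k^3,\varphi_k)_{L^2}=(a\varphi_k\phi_k^2,\phi_k)_{L^2},\quad e_k=(a\phi_k^3,\phi_k)_{L^2},$$ and, for any fixed norm $\|\cdot\|$ on $\mathbb R^2$,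 as $(\lambda,x_1,x_2)\to(\sigma_k,0,0)$, $$R_1(\lambda,x_1,x_2),\,R_2(\lambda,x_1,x_2)=O\Big(\sum_{j=0}^4|\lambda-\sigma_k|^j\,\|(x_1,x_2)\|^{4-j}\Big).$$ -/

import Mathlib

open MeasureTheory Set Filter Topology Asymptotics
open scoped ContDiff

noncomputable section

namespace PeriodicReduction

/-- Lebesgue measure on a period interval `(0, T]`. -/
abbrev mu (T : ℝ) : Measure ℝ := volume.restrict (Ioc 0 T)

/-- The real Hilbert space `L²(ℝ/Tℤ)`, with inner product `(u, v) = ∫₀ᵀ u v`. -/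
abbrev L2 (T : ℝ) : Type := Lp ℝ 2 (mu T)

/-- `u` is (a.e. equal on `(0, T]` to) an absolutely continuous function `f` on `[0, T]` with
derivative `v` almost everywhere, and `f` satisfies the boundary condition `f T = f 0`. -/
def IsPeriodicDeriv {T : ℝ} (u v : L2 T) : Prop :=
  ∃ f : ℝ → ℝ, u =ᵐ[mu T] f ∧ (∀ t ∈ Icc 0 T, f t = f 0 + ∫ s in (0 : ℝ)..t, v s) ∧ f T = f 0

lemma intervalIntegrable_L2 {T : ℝ} (v : L2 T) {t : ℝ} (ht : t ∈ Icc 0 T) :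
    IntervalIntegrable v volume 0 t := by
  rw [intervalIntegrable_iff_integrableOn_Ioc_of_le ht.1]
  have h : IntegrableOn v (Ioc 0 T) volume := (Lp.memLp v).integrable (by norm_num)
  exact h.mono_set (Ioc_subset_Ioc_right ht.2)

lemma intervalIntegral_congr_L2 {T : ℝ} {v w : ℝ → ℝ} (h : v =ᵐ[mu T] w) {t : ℝ}
    (ht : t ∈ Icc 0 T) : ∫ s in (0 : ℝ)..t, v s = ∫ s in (0 : ℝ)..t, w s := by
  rw [intervalIntegral.integral_of_le ht.1, intervalIntegral.integral_of_le ht.1]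
  exact integral_congr_ae
    (ae_mono (Measure.restrict_mono (Ioc_subset_Ioc_right ht.2) le_rfl) h)

lemma IsPeriodicDeriv.zero {T : ℝ} : IsPeriodicDeriv (0 : L2 T) 0 := by
  refine ⟨fun _ => 0, Lp.coeFn_zero _ _ _, fun t ht => ?_, rfl⟩
  rw [intervalIntegral_congr_L2 (Lp.coeFn_zero ℝ 2 (mu T)) ht]
  simp

lemma IsPeriodicDeriv.add {T : ℝ} {u v u' v' : L2 T} (h : IsPeriodicDeriv u v)
    (h' : IsPeriodicDeriv u' v') : IsPeriodicDeriv (u + u') (v + v') := by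
  obtain ⟨f, hf, hfi, hp⟩ := h
  obtain ⟨g, hg, hgi, hq⟩ := h'
  refine ⟨fun t => f t + g t, ?_, fun t ht => ?_, by simp [hp, hq]⟩
  · filter_upwards [Lp.coeFn_add u u', hf, hg] with t h1 h2 h3
    rw [h1, Pi.add_apply, h2, h3]
  · rw [intervalIntegral_congr_L2 (Lp.coeFn_add v v') ht]
    simp only [Pi.add_apply]
    rw [intervalIntegral.integral_add (intervalIntegrable_L2 v ht) (intervalIntegrable_L2 v' ht),
      hfi t ht, hgi t ht]
    ring

lemma IsPeriodicDeriv.smul {T : ℝ} {u v : L2 T} (c : ℝ) (h : IsPeriodicDeriv u v) :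
    IsPeriodicDeriv (c • u) (c • v) := by
  obtain ⟨f, hf, hfi, hp⟩ := h
  refine ⟨fun t => c * f t, ?_, fun t ht => ?_, by simp [hp]⟩
  · filter_upwards [Lp.coeFn_smul c u, hf] with t h1 h2
    rw [h1, Pi.smul_apply, h2, smul_eq_mul]
  · rw [intervalIntegral_congr_L2 (Lp.coeFn_smul c v) ht]
    simp only [Pi.smul_apply, smul_eq_mul]
    rw [intervalIntegral.integral_const_mul, hfi t ht]
    ring

/-- The Sobolev space `H²(ℝ/Tℤ)` of `u ∈ H²([0, T])` with `u(0) = u(T)` and `u'(0) = u'(T)`.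
An element is recorded as the triple `(u, u', u'')` of functions in `L²`, in which `u` determines
the other two entries. The inner product induced by the `ℓ²` product is the one of `H²`,
`(u, v) = ∑_{α ≤ 2} ∫₀ᵀ D^α u D^α v`. -/
def H2 (T : ℝ) : Submodule ℝ (PiLp 2 fun _ : Fin 3 => L2 T) where
  carrier := {u | IsPeriodicDeriv (u 0) (u 1) ∧ IsPeriodicDeriv (u 1) (u 2)}
  zero_mem' := ⟨IsPeriodicDeriv.zero, IsPeriodicDeriv.zero⟩
  add_mem' := fun h h' => ⟨h.1.add h'.1, h.2.add h'.2⟩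
  smul_mem' := fun c _ h => ⟨h.1.smul c, h.2.smul c⟩

/-- `D^α u` for `u ∈ H²` and `α = 0, 1, 2`, as a continuous linear map `H² → L²`. -/
def deriv2 (T : ℝ) (α : Fin 3) : H2 T →L[ℝ] L2 T :=
  (PiLp.proj 2 (fun _ : Fin 3 => L2 T) α).comp (H2 T).subtypeL

/-- The linear operator `𝔏(lam) u = u'' + lam u` from `H²` to `L²`. -/
def linOp (T lam : ℝ) : H2 T →L[ℝ] L2 T := deriv2 T 2 + lam • deriv2 T 0

lemma memLp_top_H2 {T : ℝ} (u : H2 T) : MemLp (deriv2 T 0 u) ⊤ (mu T) := by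
  obtain ⟨⟨f, hf, hfi, -⟩, -⟩ := u.2
  change MemLp (u.1 0) ⊤ (mu T)
  have hv : IntegrableOn (u.1 1) (Ioc 0 T) volume := (Lp.memLp (u.1 1)).integrable (by norm_num)
  refine memLp_top_of_bound (Lp.aestronglyMeasurable _)
    (|f 0| + ∫ s in Ioc 0 T, ‖u.1 1 s‖) ?_
  filter_upwards [hf, ae_restrict_mem measurableSet_Ioc] with t ht htm
  have htm' : t ∈ Icc 0 T := ⟨htm.1.le, htm.2⟩
  rw [ht, hfi t htm']
  refine (norm_add_le _ _).trans (add_le_add le_rfl ?_)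
  rw [intervalIntegral.integral_of_le htm'.1]
  refine (norm_integral_le_integral_norm _).trans ?_
  exact setIntegral_mono_set hv.norm (Eventually.of_forall fun _ => norm_nonneg _)
    (Ioc_subset_Ioc_right htm.2).eventuallyLE

lemma memLp_cubic {T : ℝ} (a : Lp ℝ ⊤ (mu T)) (u : H2 T) :
    MemLp (fun t => a t * deriv2 T 0 u t ^ 3) 2 (mu T) := by
  have hu := memLp_top_H2 u
  have h2 := hu.mul (r := ⊤) hu
  have h3 := hu.mul (r := ⊤) h2
  have h4 := h3.mul (r := ⊤) (Lp.memLp a)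
  refine MemLp.mono_exponent ((memLp_congr_ae ?_).1 h4) le_top
  refine Eventually.of_forall fun t => ?_
  simp only [Pi.mul_apply]
  ring

/-- The nonlinear operator `𝔉(lam, u) = u'' + lam u + a(t) u³` from `ℝ × H²` to `L²`. -/
def nonlinOp {T : ℝ} (a : Lp ℝ ⊤ (mu T)) (lam : ℝ) (u : H2 T) : L2 T :=
  linOp T lam u + (memLp_cubic a u).toLp

/-- `σ_k = (2πk/T)²`. -/
def sigma (T : ℝ) (k : ℕ) : ℝ := (2 * Real.pi * k / T) ^ 2

/-- The normalized function `φ_k(t) = √(2/T) cos(2πkt/T)`. -/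
def cosMode (T : ℝ) (k : ℕ) (t : ℝ) : ℝ := √(2 / T) * Real.cos (2 * Real.pi * k / T * t)

/-- The normalized function `ϕ_k(t) = √(2/T) sin(2πkt/T)`. -/
def sinMode (T : ℝ) (k : ℕ) (t : ℝ) : ℝ := √(2 / T) * Real.sin (2 * Real.pi * k / T * t)

lemma continuous_cosMode (T : ℝ) (k : ℕ) : Continuous (cosMode T k) := by
  unfold cosMode; fun_prop

lemma continuous_sinMode (T : ℝ) (k : ℕ) : Continuous (sinMode T k) := by
  unfold sinMode; fun_prop

lemma memLp_of_continuous (T : ℝ) {f : ℝ → ℝ} (hf : Continuous f) : MemLp f 2 (mu T) := by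
  obtain ⟨C, hC⟩ := (isCompact_Icc (a := (0 : ℝ)) (b := T)).exists_bound_of_continuousOn
    hf.continuousOn
  refine MemLp.of_bound hf.aestronglyMeasurable C ?_
  filter_upwards [ae_restrict_mem measurableSet_Ioc] with t ht
  exact hC t ⟨ht.1.le, ht.2⟩

/-- The class in `L²` of a continuous function. -/
def ofCont (T : ℝ) (f : ℝ → ℝ) (hf : Continuous f) : L2 T := (memLp_of_continuous T hf).toLp

lemma isPeriodicDeriv_ofCont {T : ℝ} {f : ℝ → ℝ} (hf : Continuous f) {v : L2 T} {c : ℝ}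
    {g : ℝ → ℝ} (hg : Continuous g) (hv : v = c • ofCont T g hg)
    (hd : ∀ t, HasDerivAt f (c * g t) t) (hp : f T = f 0) :
    IsPeriodicDeriv (ofCont T f hf) v := by
  refine ⟨f, MemLp.coeFn_toLp _, fun t ht => ?_, hp⟩
  have h : v =ᵐ[mu T] fun t => c * g t := by
    rw [hv]
    filter_upwards [Lp.coeFn_smul c (ofCont T g hg), (memLp_of_continuous T hg).coeFn_toLp]
      with s h1 h2
    rw [h1, Pi.smul_apply, smul_eq_mul, ofCont, h2]
  rw [intervalIntegral_congr_L2 h ht,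
    intervalIntegral.integral_eq_sub_of_hasDerivAt (fun s _ => hd s)
      ((continuous_const.mul hg).intervalIntegrable _ _)]
  ring

/-- `φ_k` as an element of `L²`. -/
def cosL2 (T : ℝ) (k : ℕ) : L2 T := ofCont T (cosMode T k) (continuous_cosMode T k)

/-- `ϕ_k` as an element of `L²`. -/
def sinL2 (T : ℝ) (k : ℕ) : L2 T := ofCont T (sinMode T k) (continuous_sinMode T k)

lemma angle_period (T : ℝ) (k : ℕ) :
    Real.cos (2 * Real.pi * k / T * T) = 1 ∧ Real.sin (2 * Real.pi * k / T * T) = 0 := by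
  rcases eq_or_ne T 0 with rfl | hT
  · simp
  · rw [div_mul_cancel₀ _ hT, show 2 * Real.pi * (k : ℝ) = k * (2 * Real.pi) by ring]
    refine ⟨Real.cos_nat_mul_two_pi k, ?_⟩
    have := Real.sin_add_nat_mul_two_pi 0 k
    simpa using this

lemma isPeriodicDeriv_cos (T : ℝ) (k : ℕ) :
    IsPeriodicDeriv (cosL2 T k) ((-(2 * Real.pi * k / T)) • sinL2 T k) := by
  refine isPeriodicDeriv_ofCont _ (continuous_sinMode T k) rfl (fun t => ?_) ?_
  · have h := (((hasDerivAt_id t).const_mul (2 * Real.pi * k / T)).cos).const_mul (√(2 / T))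
    refine h.congr_deriv ?_
    simp only [sinMode, id]
    ring
  · simp [cosMode, (angle_period T k).1]

lemma isPeriodicDeriv_sin (T : ℝ) (k : ℕ) :
    IsPeriodicDeriv (sinL2 T k) ((2 * Real.pi * k / T) • cosL2 T k) := by
  refine isPeriodicDeriv_ofCont _ (continuous_cosMode T k) rfl (fun t => ?_) ?_
  · have h := (((hasDerivAt_id t).const_mul (2 * Real.pi * k / T)).sin).const_mul (√(2 / T))
    refine h.congr_deriv ?_
    simp only [cosMode, id]
    ring
  · simp [sinMode, (angle_period T k).2]

/-- `φ_k` as an element of `H²`. -/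
def cosH2 (T : ℝ) (k : ℕ) : H2 T :=
  ⟨WithLp.toLp 2 ![cosL2 T k, (-(2 * Real.pi * k / T)) • sinL2 T k, (-sigma T k) • cosL2 T k], by
    refine ⟨isPeriodicDeriv_cos T k, ?_⟩
    have h := (isPeriodicDeriv_sin T k).smul (-(2 * Real.pi * k / T))
    rw [smul_smul] at h
    have e : -(2 * Real.pi * k / T) * (2 * Real.pi * k / T) = -sigma T k := by
      unfold sigma; ring
    rw [e] at h
    exact h⟩

/-- `ϕ_k` as an element of `H²`. -/
def sinH2 (T : ℝ) (k : ℕ) : H2 T :=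
  ⟨WithLp.toLp 2 ![sinL2 T k, (2 * Real.pi * k / T) • cosL2 T k, (-sigma T k) • sinL2 T k], by
    refine ⟨isPeriodicDeriv_sin T k, ?_⟩
    have h := (isPeriodicDeriv_cos T k).smul (2 * Real.pi * k / T)
    rw [smul_smul] at h
    have e : (2 * Real.pi * k / T) * -(2 * Real.pi * k / T) = -sigma T k := by
      unfold sigma; ring
    rw [e] at h
    exact h⟩

/-- The null space `N[𝔏(σ_k)] ⊆ H²`. -/
abbrev kernel (T : ℝ) (k : ℕ) : Submodule ℝ (H2 T) := (linOp T (sigma T k)).ker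

lemma cosH2_mem (T : ℝ) (k : ℕ) : cosH2 T k ∈ kernel T k := by
  change (-sigma T k) • cosL2 T k + sigma T k • cosL2 T k = 0
  rw [← add_smul, neg_add_cancel, zero_smul]

lemma sinH2_mem (T : ℝ) (k : ℕ) : sinH2 T k ∈ kernel T k := by
  change (-sigma T k) • sinL2 T k + sigma T k • sinL2 T k = 0
  rw [← add_smul, neg_add_cancel, zero_smul]

/-- `L : ℝ² → N[𝔏(σ_k)]`, `L(x₁, x₂) = x₁ φ_k + x₂ ϕ_k`. -/
def coordMap (T : ℝ) (k : ℕ) (x : ℝ × ℝ) : kernel T k :=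
  x.1 • ⟨cosH2 T k, cosH2_mem T k⟩ + x.2 • ⟨sinH2 T k, sinH2_mem T k⟩

/-- The projection `Q_k v = (v, φ_k) φ_k + (v, ϕ_k) ϕ_k` in `L²`. -/
def projQ (T : ℝ) (k : ℕ) (v : L2 T) : L2 T :=
  (inner ℝ v (cosL2 T k)) • cosL2 T k + (inner ℝ v (sinL2 T k)) • sinL2 T k

/-- The auxiliary function `𝒢_k(lam, x, y) = (I - Q_k) 𝔉(lam, x + y)` on
`ℝ × N[𝔏(σ_k)] × N[𝔏(σ_k)]^⊥`, the orthogonal complement being taken in `H²`. -/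
def auxMap {T : ℝ} (a : Lp ℝ ⊤ (mu T)) (k : ℕ) (lam : ℝ) (x : kernel T k)
    (y : (kernel T k)ᗮ) : L2 T :=
  nonlinOp a lam ((x : H2 T) + (y : H2 T)) - projQ T k (nonlinOp a lam ((x : H2 T) + (y : H2 T)))

/-- `ψ` is a smooth function on the product of the open neighbourhoods `I` of `σ_k` in `ℝ` and
`N` of `0` in `N[𝔏(σ_k)]`, with values in `N[𝔏(σ_k)]^⊥`, which solves the auxiliary equation
`(I - Q_k) 𝔉(lam, x + ψ(lam, x)) = 0` with `ψ(σ_k, 0) = 0`. -/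
structure IsReduction {T : ℝ} (a : Lp ℝ ⊤ (mu T)) (k : ℕ) (I : Set ℝ) (N : Set (kernel T k))
    (ψ : ℝ × kernel T k → (kernel T k)ᗮ) : Prop where
  isOpen_I : IsOpen I
  mem_I : sigma T k ∈ I
  isOpen_N : IsOpen N
  zero_mem_N : 0 ∈ N
  smooth : ContDiffOn ℝ ∞ ψ (I ×ˢ N)
  base : ψ (sigma T k, 0) = 0
  solves : ∀ lam ∈ I, ∀ x ∈ N, auxMap a k lam x (ψ (lam, x)) = 0

/-- `Q_k 𝔉(lam, L(x₁, x₂) + ψ(lam, L(x₁, x₂)))`. -/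
def reducedVec {T : ℝ} (a : Lp ℝ ⊤ (mu T)) (k : ℕ) (ψ : ℝ × kernel T k → (kernel T k)ᗮ)
    (p : ℝ × ℝ × ℝ) : L2 T :=
  projQ T k (nonlinOp a p.1
    ((coordMap T k p.2 : H2 T) + (ψ (p.1, coordMap T k p.2) : H2 T)))

/-- The first component `h₁(lam, x₁, x₂)` of the reduced map. -/
def h1 {T : ℝ} (a : Lp ℝ ⊤ (mu T)) (k : ℕ) (ψ : ℝ × kernel T k → (kernel T k)ᗮ)
    (p : ℝ × ℝ × ℝ) : ℝ :=
  inner ℝ (reducedVec a k ψ p) (cosL2 T k)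

/-- The second component `h₂(lam, x₁, x₂)` of the reduced map. -/
def h2 {T : ℝ} (a : Lp ℝ ⊤ (mu T)) (k : ℕ) (ψ : ℝ × kernel T k → (kernel T k)ᗮ)
    (p : ℝ × ℝ × ℝ) : ℝ :=
  inner ℝ (reducedVec a k ψ p) (sinL2 T k)

/-- `(a f, g)_{L²} = ∫₀ᵀ a(t) f(t) g(t) dt`. -/
def pairing {T : ℝ} (a : Lp ℝ ⊤ (mu T)) (f g : ℝ → ℝ) : ℝ :=
  ∫ t in (0 : ℝ)..T, a t * f t * g t

/-- `a_k = (a φ_k³, φ_k)`. -/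
def coeffA {T : ℝ} (a : Lp ℝ ⊤ (mu T)) (k : ℕ) : ℝ :=
  pairing a (fun t => cosMode T k t ^ 3) (cosMode T k)

/-- `b_k = (a φ_k² ϕ_k, φ_k)`. -/
def coeffB {T : ℝ} (a : Lp ℝ ⊤ (mu T)) (k : ℕ) : ℝ :=
  pairing a (fun t => cosMode T k t ^ 2 * sinMode T k t) (cosMode T k)

/-- `c_k = (a φ_k ϕ_k², φ_k)`. -/
def coeffC {T : ℝ} (a : Lp ℝ ⊤ (mu T)) (k : ℕ) : ℝ :=
  pairing a (fun t => cosMode T k t * sinMode T k t ^ 2) (cosMode T k)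

/-- `d_k = (a ϕ_k³, φ_k)`. -/
def coeffD {T : ℝ} (a : Lp ℝ ⊤ (mu T)) (k : ℕ) : ℝ :=
  pairing a (fun t => sinMode T k t ^ 3) (cosMode T k)

/-- `e_k = (a ϕ_k³, ϕ_k)`. -/
def coeffE {T : ℝ} (a : Lp ℝ ⊤ (mu T)) (k : ℕ) : ℝ :=
  pairing a (fun t => sinMode T k t ^ 3) (sinMode T k)

end PeriodicReduction

end

open PeriodicReduction

noncomputable section

namespace PeriodicReduction

/-! ### Primitives in L², integration by parts, completeness of H² -/

section Primitive

variable {T : ℝ}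

/-! This is a Lyapunov–Schmidt reduction in which the cubic nonlinearity makes every error explicit.

Existence. H² is a closed subspace of a product of three copies of L², hence complete
(`completeSpace_H2`), and it embeds in L^∞ (`exists_sup_bound`), so u ↦ a u³ is the diagonal of a
bounded trilinear map and 𝔉 is analytic. By integration by parts the range of 𝔏(σ_k) is orthogonal
to both modes; by variation of parameters it is all of their orthogonal complement
(`exists_linOp_eq`). Hence (I - Q_k) 𝔏(σ_k) is a bijection from N_k^⊥ onto the range of I - Q_k
(`bijective_auxLin`). As the cubic term has zero derivative at 0, the implicit function theorem
gives ψ together with local uniqueness (`exists_implicit_orthogonal`). That the two modes span the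
kernel is never needed.

Expansion. Let x = L(x₁, x₂) and y = ψ(lam, x). The linear part of x is a multiple of modes, so I -
Q_k kills it, and the auxiliary equation expresses 𝔏(σ_k) y through (lam - σ_k) y and a (x + y)³.
For lam near σ_k and y small the terms in y are absorbed on the left, leaving ‖y‖ = O(‖x‖³)
(`IsReduction.exists_norm_le`). So replacing a (x + y)³ by a x³ costs O(‖x‖⁵)
(`IsReduction.exists_trilin_sub_le`). The linear part contributes exactly (lam - σ_k) xᵢ, because
orthogonality to the modes in H² implies it in L² (`inner_modes_of_mem_orthogonal`). The binomial
expansion of a x³ gives the coefficients, and the remainder is already bounded by the j = 0 term of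
the stated sum.

This argument applies to any reduction: it uses only the auxiliary equation, continuity of ψ and
ψ(σ_k, 0) = 0. -/

lemma integral_mu_eq (hT : 0 ≤ T) (f : ℝ → ℝ) : ∫ t, f t ∂mu T = ∫ t in (0 : ℝ)..T, f t :=
  (intervalIntegral.integral_of_le hT).symm

lemma inner_L2_eq (hT : 0 ≤ T) (u v : L2 T) : inner ℝ u v = ∫ t in (0 : ℝ)..T, u t * v t := by
  rw [L2.inner_def, ← integral_mu_eq hT]
  refine integral_congr_ae (Eventually.of_forall fun t => ?_)
  simp [mul_comm]

lemma intervalIntegral_congr_mu (hT : 0 ≤ T) {f g : ℝ → ℝ} (h : f =ᵐ[mu T] g) :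
    ∫ t in (0 : ℝ)..T, f t = ∫ t in (0 : ℝ)..T, g t := by
  rw [← integral_mu_eq hT, ← integral_mu_eq hT]
  exact integral_congr_ae h

lemma memLp_of_continuousOn {f : ℝ → ℝ} (hf : ContinuousOn f (Icc 0 T)) : MemLp f 2 (mu T) := by
  obtain ⟨C, hC⟩ := (isCompact_Icc (a := (0 : ℝ)) (b := T)).exists_bound_of_continuousOn hf
  refine MemLp.of_bound
    ((hf.mono Ioc_subset_Icc_self).aestronglyMeasurable measurableSet_Ioc) C ?_
  filter_upwards [ae_restrict_mem measurableSet_Ioc] with t ht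
  exact hC t ⟨ht.1.le, ht.2⟩

lemma continuousOn_primitive {v : ℝ → ℝ} (hT : 0 ≤ T) (hv : IntervalIntegrable v volume 0 T) :
    ContinuousOn (fun t => ∫ s in (0 : ℝ)..t, v s) (Icc 0 T) := by
  have := intervalIntegral.continuousOn_primitive_interval (a := 0) (b := T) (f := v) (μ := volume)
    (by rwa [uIcc_of_le hT, integrableOn_Icc_iff_integrableOn_Ioc,
      ← intervalIntegrable_iff_integrableOn_Ioc_of_le hT])
  rwa [uIcc_of_le hT] at this

/-- The product rule for primitives, in integrated form. -/
lemma integral_mul_primitive {v w : ℝ → ℝ} {t : ℝ} (c d : ℝ)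
    (hv : IntervalIntegrable v volume 0 t) (hw : IntervalIntegrable w volume 0 t) :
    ∫ s in (0 : ℝ)..t, (v s * (d + ∫ r in (0 : ℝ)..s, w r) + (c + ∫ r in (0 : ℝ)..s, v r) * w s)
      = (c + ∫ r in (0 : ℝ)..t, v r) * (d + ∫ r in (0 : ℝ)..t, w r) - c * d := by
  -- A primitive of an integrable function is absolutely continuous with the expected derivative
  -- almost everywhere, which is all that integration by parts requires.
  have key : ∀ {v : ℝ → ℝ} (c : ℝ), IntervalIntegrable v volume 0 t →
      AbsolutelyContinuousOnInterval (fun s => c + ∫ r in (0 : ℝ)..s, v r) 0 t ∧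
      ∀ᵐ s, s ∈ uIcc 0 t → HasDerivAt (fun s => c + ∫ r in (0 : ℝ)..s, v r) (v s) s := by
    intro v c hv
    refine ⟨AbsolutelyContinuousOnInterval.fun_add ?_
      (hv.absolutelyContinuousOnInterval_intervalIntegral (by simp)), ?_⟩
    · exact (LipschitzWith.const c).lipschitzOnWith.absolutelyContinuousOnInterval
    · filter_upwards [hv.ae_hasDerivAt_integral] with s hs hs'
      exact (hs hs' 0 (by simp)).const_add c
  have h := (key c hv).1.integral_deriv_mul_eq_sub (key d hw).1
  simp only [intervalIntegral.integral_same, add_zero] at h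
  rw [← h]
  refine intervalIntegral.integral_congr_ae ?_
  filter_upwards [(key c hv).2, (key d hw).2] with s h1 h2 h3
  rw [(h1 (uIoc_subset_uIcc h3)).deriv, (h2 (uIoc_subset_uIcc h3)).deriv]

/-- The product rule with one C¹ factor; it differentiates the variation of parameters formula,
where g is a sine or a cosine. -/
lemma mul_primitive_eq {g g' h : ℝ → ℝ} (hg : ∀ t, HasDerivAt g (g' t) t) (hg' : Continuous g')
    {t : ℝ} (hh : IntervalIntegrable h volume 0 t) :
    g t * ∫ s in (0 : ℝ)..t, h s
      = ∫ s in (0 : ℝ)..t, (g' s * (∫ r in (0 : ℝ)..s, h r) + g s * h s) := by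
  have e : ∀ s, g 0 + ∫ r in (0 : ℝ)..s, g' r = g s := fun s => by
    rw [intervalIntegral.integral_eq_sub_of_hasDerivAt (fun r _ => hg r)
      (hg'.intervalIntegrable _ _)]
    ring
  have := integral_mul_primitive (g 0) 0 (hg'.intervalIntegrable 0 t) hh
  simp only [e, zero_add, mul_zero, sub_zero] at this
  exact this.symm

/-- Integration by parts for periodic functions. -/
lemma IsPeriodicDeriv.inner_add_inner (hT : 0 ≤ T) {u u' v v' : L2 T} (hu : IsPeriodicDeriv u u')
    (hv : IsPeriodicDeriv v v') : inner ℝ u' v + inner ℝ u v' = 0 := by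
  obtain ⟨f, hf, hfi, hfp⟩ := hu
  obtain ⟨g, hg, hgi, hgp⟩ := hv
  have hTm : T ∈ Icc 0 T := ⟨hT, le_rfl⟩
  have hu' := intervalIntegrable_L2 u' hTm
  have hv' := intervalIntegrable_L2 v' hTm
  have hu1 : u =ᵐ[mu T] fun t => f 0 + ∫ s in (0 : ℝ)..t, u' s := by
    filter_upwards [hf, ae_restrict_mem measurableSet_Ioc] with t h1 h2
    rw [h1, hfi t ⟨h2.1.le, h2.2⟩]
  have hv1 : v =ᵐ[mu T] fun t => g 0 + ∫ s in (0 : ℝ)..t, v' s := by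
    filter_upwards [hg, ae_restrict_mem measurableSet_Ioc] with t h1 h2
    rw [h1, hgi t ⟨h2.1.le, h2.2⟩]
  have key := integral_mul_primitive (f 0) (g 0) hu' hv'
  rw [← hfi T hTm, ← hgi T hTm, hfp, hgp, sub_self] at key
  rw [L2.inner_def, L2.inner_def, ← integral_add (L2.integrable_inner u' v)
    (L2.integrable_inner u v'), ← key, ← integral_mu_eq hT]
  refine integral_congr_ae ?_
  filter_upwards [hu1, hv1] with t h1 h2
  simp only [RCLike.inner_apply, conj_trivial, h1, h2]
  ring

/-- Hölder's inequality on a finite measure space; the constant is the total mass to the power 1/1 -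
1/2. -/
lemma exists_integral_norm_le (T : ℝ) :
    ∃ C, 0 ≤ C ∧ ∀ w : L2 T, ∫ s in Ioc 0 T, ‖w s‖ ≤ C * ‖w‖ := by
  refine ⟨((mu T univ) ^ ((1 : ℝ) / 2)).toReal, ENNReal.toReal_nonneg, fun w => ?_⟩
  have h := eLpNorm_le_eLpNorm_mul_rpow_measure_univ (p := 1) (q := 2) (μ := mu T) (f := w)
    (by norm_num) (Lp.aestronglyMeasurable w)
  have hfin : (mu T univ) ^ ((1 : ℝ) / 2) ≠ ⊤ := by finiteness
  have h2 := ENNReal.toReal_mono (ENNReal.mul_ne_top (Lp.eLpNorm_ne_top w)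
    (by norm_num)) h
  rw [ENNReal.toReal_mul] at h2
  rw [integral_norm_eq_lintegral_enorm (Lp.aestronglyMeasurable w), ← eLpNorm_one_eq_lintegral_enorm,
    Lp.norm_def, mul_comm]
  convert h2 using 3
  norm_num

lemma exists_primitive_le (T : ℝ) : ∃ C, 0 ≤ C ∧ ∀ (w : L2 T), ∀ t ∈ Icc 0 T,
    |∫ s in (0 : ℝ)..t, w s| ≤ C * ‖w‖ := by
  obtain ⟨C, hC, h⟩ := exists_integral_norm_le T
  refine ⟨C, hC, fun w t ht => le_trans ?_ (h w)⟩
  have hw : IntegrableOn w (Ioc 0 T) volume := (Lp.memLp w).integrable (by norm_num)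
  rw [intervalIntegral.integral_of_le ht.1, ← Real.norm_eq_abs]
  refine (norm_integral_le_integral_norm _).trans ?_
  exact setIntegral_mono_set hw.norm (Eventually.of_forall fun _ => norm_nonneg _)
    (Ioc_subset_Ioc_right ht.2).eventuallyLE

lemma intervalIntegrable_top (hT : 0 ≤ T) (w : L2 T) : IntervalIntegrable w volume 0 T :=
  intervalIntegrable_L2 w ⟨hT, le_rfl⟩

/-- `v ↦ (t ↦ ∫₀ᵗ v)` as a continuous linear map on `L²`. -/
def primitiveL (hT : 0 ≤ T) : L2 T →L[ℝ] L2 T :=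
  LinearMap.mkContinuousOfExistsBound
    { toFun := fun v =>
        (memLp_of_continuousOn (continuousOn_primitive hT (intervalIntegrable_top hT v))).toLp
      map_add' := fun v w => by
        rw [← MemLp.toLp_add]
        refine MemLp.toLp_congr _ _ ?_
        filter_upwards [ae_restrict_mem measurableSet_Ioc] with t ht
        have ht' : t ∈ Icc 0 T := ⟨ht.1.le, ht.2⟩
        rw [intervalIntegral_congr_L2 (Lp.coeFn_add v w) ht']
        exact intervalIntegral.integral_add (intervalIntegrable_L2 v ht')
          (intervalIntegrable_L2 w ht')
      map_smul' := fun c v => by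
        rw [RingHom.id_apply, ← MemLp.toLp_const_smul]
        refine MemLp.toLp_congr _ _ ?_
        filter_upwards [ae_restrict_mem measurableSet_Ioc] with t ht
        rw [intervalIntegral_congr_L2 (Lp.coeFn_smul c v) ⟨ht.1.le, ht.2⟩]
        exact intervalIntegral.integral_const_mul c _ } <| by
    obtain ⟨C, hC, h⟩ := exists_primitive_le T
    refine ⟨(measureUnivNNReal (mu T) : ℝ) ^ (2 : ENNReal).toReal⁻¹ * C, fun v => ?_⟩
    rw [mul_assoc]
    refine Lp.norm_le_of_ae_bound (by positivity) ?_
    filter_upwards [MemLp.coeFn_toLp (memLp_of_continuousOn (continuousOn_primitive hT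
      (intervalIntegrable_top hT v))), ae_restrict_mem measurableSet_Ioc] with t ht htm
    refine (le_of_eq ?_).trans (h v t ⟨htm.1.le, htm.2⟩)
    exact congrArg norm ht

lemma coeFn_primitiveL (hT : 0 ≤ T) (v : L2 T) :
    primitiveL hT v =ᵐ[mu T] fun t => ∫ s in (0 : ℝ)..t, v s :=
  MemLp.coeFn_toLp (memLp_of_continuousOn (continuousOn_primitive hT (intervalIntegrable_top hT v)))

/-- The constant function `1` in `L²`. -/
def oneL2 (T : ℝ) : L2 T := ofCont T (fun _ => 1) continuous_const

lemma coeFn_oneL2 (T : ℝ) : oneL2 T =ᵐ[mu T] fun _ => 1 :=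
  (memLp_of_continuous T continuous_const).coeFn_toLp

/-- Replaces the existential over representatives by conditions stable under L² limits: u differs
from the primitive of v by a constant, and periodicity means that v has zero mean. -/
lemma isPeriodicDeriv_iff (hT : 0 ≤ T) (u v : L2 T) :
    IsPeriodicDeriv u v ↔
      u - primitiveL hT v ∈ Submodule.span ℝ {oneL2 T} ∧ inner ℝ (oneL2 T) v = 0 := by
  have hTm : T ∈ Icc 0 T := ⟨hT, le_rfl⟩
  have h1 : inner ℝ (oneL2 T) v = ∫ s in (0 : ℝ)..T, v s := by
    rw [inner_L2_eq hT]
    refine intervalIntegral_congr_mu hT ?_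
    filter_upwards [coeFn_oneL2 T] with t ht
    rw [ht, one_mul]
  rw [h1, Submodule.mem_span_singleton]
  constructor
  · rintro ⟨f, hf, hfi, hp⟩
    refine ⟨⟨f 0, ?_⟩, ?_⟩
    · ext1
      filter_upwards [hf, coeFn_primitiveL hT v, Lp.coeFn_sub u (primitiveL hT v),
        Lp.coeFn_smul (f 0) (oneL2 T), coeFn_oneL2 T, ae_restrict_mem measurableSet_Ioc]
        with t h1 h2 h3 h4 h5 h6
      rw [h3, h4, Pi.sub_apply, Pi.smul_apply, h5, h1, h2, hfi t ⟨h6.1.le, h6.2⟩]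
      simp
    · have := hfi T hTm
      linarith
  · rintro ⟨⟨c, hc⟩, hv⟩
    refine ⟨fun t => c + ∫ s in (0 : ℝ)..t, v s, ?_, fun t _ => by simp, by simp [hv]⟩
    have hc' : u = c • oneL2 T + primitiveL hT v := by rw [hc, sub_add_cancel]
    rw [hc']
    filter_upwards [coeFn_primitiveL hT v, Lp.coeFn_add (c • oneL2 T) (primitiveL hT v),
      Lp.coeFn_smul c (oneL2 T), coeFn_oneL2 T] with t h1 h2 h3 h4
    rw [h2, Pi.add_apply, h3, Pi.smul_apply, h4, h1]
    simp

lemma isClosed_isPeriodicDeriv (hT : 0 ≤ T) :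
    IsClosed {p : L2 T × L2 T | IsPeriodicDeriv p.1 p.2} := by
  simp only [isPeriodicDeriv_iff hT, ofPred_and]
  refine IsClosed.inter ?_ ?_
  · exact (Submodule.closed_of_finiteDimensional _).preimage
      (continuous_fst.sub ((primitiveL hT).continuous.comp continuous_snd))
  · exact isClosed_eq (continuous_const.inner continuous_snd) continuous_const

lemma isClosed_H2 (hT : 0 ≤ T) : IsClosed (H2 T : Set (PiLp 2 fun _ : Fin 3 => L2 T)) := by
  have h := isClosed_isPeriodicDeriv hT
  have hp : ∀ i : Fin 3, Continuous fun u : PiLp 2 fun _ : Fin 3 => L2 T => u i :=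
    fun i => (PiLp.proj (𝕜 := ℝ) 2 (fun _ : Fin 3 => L2 T) i).continuous
  exact (h.preimage ((hp 0).prodMk (hp 1))).inter (h.preimage ((hp 1).prodMk (hp 2)))

lemma completeSpace_H2 (hT : 0 ≤ T) : CompleteSpace (H2 T) :=
  (isClosed_H2 hT).completeSpace_coe

end Primitive

/-! ### Orthonormality of the two modes -/

section Modes

variable {T : ℝ} {k : ℕ}

lemma coeFn_ofCont (T : ℝ) {f : ℝ → ℝ} (hf : Continuous f) : ofCont T f hf =ᵐ[mu T] f :=
  (memLp_of_continuous T hf).coeFn_toLp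

lemma inner_ofCont (hT : 0 ≤ T) {f g : ℝ → ℝ} (hf : Continuous f) (hg : Continuous g) :
    inner ℝ (ofCont T f hf) (ofCont T g hg) = ∫ t in (0 : ℝ)..T, f t * g t := by
  rw [inner_L2_eq hT]
  refine intervalIntegral_congr_mu hT ?_
  filter_upwards [coeFn_ofCont T hf, coeFn_ofCont T hg] with t h1 h2
  rw [h1, h2]

lemma inner_ofCont_right (hT : 0 ≤ T) (v : L2 T) {g : ℝ → ℝ} (hg : Continuous g) :
    inner ℝ v (ofCont T g hg) = ∫ t in (0 : ℝ)..T, v t * g t := by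
  rw [inner_L2_eq hT]
  refine intervalIntegral_congr_mu hT ?_
  filter_upwards [coeFn_ofCont T hg] with t h2
  rw [h2]

lemma frequency_pos (hT : 0 < T) (hk : 1 ≤ k) : 0 < 2 * Real.pi * k / T := by
  have : (0 : ℝ) < k := by exact_mod_cast hk
  have := Real.pi_pos
  positivity

lemma inner_modes (hT : 0 < T) (hk : 1 ≤ k) :
    inner ℝ (cosL2 T k) (cosL2 T k) = 1 ∧ inner ℝ (sinL2 T k) (sinL2 T k) = 1 ∧
      inner ℝ (cosL2 T k) (sinL2 T k) = 0 := by
  have hw := frequency_pos hT hk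
  obtain ⟨hc, hs⟩ := angle_period T k
  rw [cosL2, sinL2, inner_ofCont hT.le, inner_ofCont hT.le, inner_ofCont hT.le]
  simp only [cosMode, sinMode]
  have h2 : √(2 / T) * √(2 / T) = 2 / T := Real.mul_self_sqrt (by positivity)
  generalize √(2 / T) = r at *
  generalize 2 * Real.pi * k / T = w at *
  have hS : ∀ t, HasDerivAt (fun s => Real.sin (w * s)) (Real.cos (w * t) * w) t := fun t => by
    simpa using ((hasDerivAt_id t).const_mul w).sin
  have hC : ∀ t, HasDerivAt (fun s => Real.cos (w * s)) (-Real.sin (w * t) * w) t := fun t => by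
    simpa using ((hasDerivAt_id t).const_mul w).cos
  have hSC := fun t => (hS t).mul (hC t)
  have hSS := fun t => (hS t).mul (hS t)
  have hsq : ∀ t, Real.sin (w * t) ^ 2 + Real.cos (w * t) ^ 2 = 1 := fun t =>
    Real.sin_sq_add_cos_sq _
  refine ⟨?_, ?_, ?_⟩
  -- In each of the three cases the antiderivative is explicit, and its oscillating part vanishes at
  -- both ends since sin(wT) = 0.
  · rw [intervalIntegral.integral_eq_sub_of_hasDerivAt
      (f := fun s => r * r / 2 * (s + Real.sin (w * s) * Real.cos (w * s) / w))
      (fun t _ => (((hasDerivAt_id t).add ((hSC t).div_const w)).const_mul _).congr_deriv ?_)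
      (Continuous.intervalIntegrable (by fun_prop) _ _)]
    · rw [h2]
      simp [hs]
      field_simp
    · field_simp
      linear_combination -r ^ 2 * hsq t
  · rw [intervalIntegral.integral_eq_sub_of_hasDerivAt
      (f := fun s => r * r / 2 * (s - Real.sin (w * s) * Real.cos (w * s) / w))
      (fun t _ => (((hasDerivAt_id t).sub ((hSC t).div_const w)).const_mul _).congr_deriv ?_)
      (Continuous.intervalIntegrable (by fun_prop) _ _)]
    · rw [h2]
      simp [hs]
      field_simp
    · field_simp
      linear_combination -r ^ 2 * hsq t
  · rw [intervalIntegral.integral_eq_sub_of_hasDerivAt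
      (f := fun s => r * r / 2 * (Real.sin (w * s) * Real.sin (w * s) / w))
      (fun t _ => (((hSS t).div_const w).const_mul _).congr_deriv ?_)
      (Continuous.intervalIntegrable (by fun_prop) _ _)]
    · simp [hs]
    · field_simp
      ring

end Modes

/-! ### The embedding H² → L^∞ and analyticity of 𝔉 -/

section Cubic

variable {T : ℝ}

/-- Writing u = c + ∫ u', the integral is bounded uniformly by ‖u'‖ in L², and the constant c by
comparing L² norms in c · 1 = u - ∫ u'. -/
lemma exists_sup_bound (hT : 0 < T) :
    ∃ C : ℝ, ∀ u : H2 T, ‖(memLp_top_H2 u).toLp‖ ≤ C * ‖u‖ := by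
  obtain ⟨C, hC, hp⟩ := exists_primitive_le T
  have hone : 0 < ‖oneL2 T‖ := by
    rw [norm_pos_iff]
    intro h
    have h1 : inner ℝ (oneL2 T) (oneL2 T) = T := by
      rw [oneL2, inner_ofCont hT.le]
      simp
    rw [h, inner_zero_left] at h1
    exact hT.ne h1
  refine ⟨(‖deriv2 T 0‖ + ‖primitiveL hT.le‖ * ‖deriv2 T 1‖) / ‖oneL2 T‖ + C * ‖deriv2 T 1‖,
    fun u => ?_⟩
  obtain ⟨hm, -⟩ := (isPeriodicDeriv_iff hT.le _ _).1 u.2.1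
  obtain ⟨c, hc⟩ := Submodule.mem_span_singleton.1 hm
  change c • oneL2 T = deriv2 T 0 u - primitiveL hT.le (deriv2 T 1 u) at hc
  have h0 := (deriv2 T 0).le_opNorm u
  have h1 := (deriv2 T 1).le_opNorm u
  have hcb : |c| ≤ (‖deriv2 T 0‖ + ‖primitiveL hT.le‖ * ‖deriv2 T 1‖) / ‖oneL2 T‖ * ‖u‖ := by
    rw [div_mul_eq_mul_div, le_div_iff₀ hone, ← Real.norm_eq_abs, ← norm_smul, hc]
    refine (norm_sub_le _ _).trans ?_
    have h2 := (primitiveL hT.le).le_opNorm (deriv2 T 1 u)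
    have h3 := mul_le_mul_of_nonneg_left h1 (norm_nonneg (primitiveL hT.le))
    linarith
  have hu : deriv2 T 0 u = c • oneL2 T + primitiveL hT.le (deriv2 T 1 u) := by
    rw [hc, sub_add_cancel]
  have hcoe : deriv2 T 0 u =ᵐ[mu T] fun t => c + ∫ s in (0 : ℝ)..t, deriv2 T 1 u s := by
    rw [hu]
    filter_upwards [coeFn_primitiveL hT.le (deriv2 T 1 u),
      Lp.coeFn_add (c • oneL2 T) (primitiveL hT.le (deriv2 T 1 u)),
      Lp.coeFn_smul c (oneL2 T), coeFn_oneL2 T] with t h1 h2 h3 h4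
    rw [h2, Pi.add_apply, h3, Pi.smul_apply, h4, h1]
    simp
  have hb := Lp.norm_le_of_ae_bound (f := (memLp_top_H2 u).toLp)
    (C := |c| + C * ‖deriv2 T 1 u‖) (by positivity) (by
      filter_upwards [(memLp_top_H2 u).coeFn_toLp, hcoe, ae_restrict_mem measurableSet_Ioc]
        with t h1 h2 h3
      rw [h1, h2]
      exact (norm_add_le _ _).trans (add_le_add le_rfl (hp _ t ⟨h3.1.le, h3.2⟩)))
  simp only [ENNReal.toReal_top, inv_zero, Real.rpow_zero, one_mul] at hb
  refine hb.trans ?_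
  have := mul_le_mul_of_nonneg_left h1 hC
  linarith

/-- The embedding `H² → L^∞`. -/
def supL (hT : 0 < T) : H2 T →L[ℝ] Lp ℝ ⊤ (mu T) :=
  LinearMap.mkContinuousOfExistsBound
    { toFun := fun u => (memLp_top_H2 u).toLp
      map_add' := fun u v => by
        rw [← MemLp.toLp_add]
        refine MemLp.toLp_congr _ _ ?_
        rw [map_add]
        exact Lp.coeFn_add _ _
      map_smul' := fun c v => by
        rw [RingHom.id_apply, ← MemLp.toLp_const_smul]
        refine MemLp.toLp_congr _ _ ?_
        rw [map_smul]
        exact Lp.coeFn_smul _ _ } (exists_sup_bound hT)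

lemma coeFn_supL (hT : 0 < T) (u : H2 T) : supL hT u =ᵐ[mu T] deriv2 T 0 u :=
  (memLp_top_H2 u).coeFn_toLp

/-- Pointwise multiplication `L^∞ × L² → L²`. -/
def mulL (T : ℝ) : Lp ℝ ⊤ (mu T) →L[ℝ] L2 T →L[ℝ] L2 T :=
  (ContinuousLinearMap.mul ℝ ℝ).holderL (mu T) ⊤ 2 2

lemma coeFn_mulL (f : Lp ℝ ⊤ (mu T)) (g : L2 T) : mulL T f g =ᵐ[mu T] fun t => f t * g t :=
  (ContinuousLinearMap.mul ℝ ℝ).coeFn_holder f g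

/-- The trilinear map `(u, v, w) ↦ a u v w` from `H²` to `L²`. -/
def trilin (hT : 0 < T) (a : Lp ℝ ⊤ (mu T)) (u v w : H2 T) : L2 T :=
  mulL T a (mulL T (supL hT u) (mulL T (supL hT v) (deriv2 T 0 w)))

lemma coeFn_trilin (hT : 0 < T) (a : Lp ℝ ⊤ (mu T)) (u v w : H2 T) :
    trilin hT a u v w =ᵐ[mu T]
      fun t => a t * (deriv2 T 0 u t * (deriv2 T 0 v t * deriv2 T 0 w t)) := by
  filter_upwards [coeFn_mulL a (mulL T (supL hT u) (mulL T (supL hT v) (deriv2 T 0 w))),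
    coeFn_mulL (supL hT u) (mulL T (supL hT v) (deriv2 T 0 w)),
    coeFn_mulL (supL hT v) (deriv2 T 0 w), coeFn_supL hT u, coeFn_supL hT v] with t h1 h2 h3 h4 h5
  rw [trilin, h1, h2, h3, h4, h5]

lemma exists_norm_trilin_le (hT : 0 < T) (a : Lp ℝ ⊤ (mu T)) :
    ∃ C, 0 ≤ C ∧ ∀ u v w, ‖trilin hT a u v w‖ ≤ C * (‖u‖ * ‖v‖ * ‖w‖) := by
  refine ⟨‖mulL T a‖ * (‖mulL T‖ * ‖supL hT‖ * (‖mulL T‖ * ‖supL hT‖ * ‖deriv2 T 0‖)),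
    by positivity, fun u v w => ?_⟩
  have hm : ∀ (u : H2 T) (f : L2 T), ‖mulL T (supL hT u) f‖ ≤ ‖mulL T‖ * ‖supL hT‖ * ‖u‖ * ‖f‖ :=
    fun u f => by
      refine ((mulL T).le_opNorm₂ _ _).trans ?_
      have := (supL hT).le_opNorm u
      rw [mul_assoc ‖mulL T‖ ‖supL hT‖]
      gcongr
  calc ‖trilin hT a u v w‖
      ≤ ‖mulL T a‖ * (‖mulL T‖ * ‖supL hT‖ * ‖u‖ * (‖mulL T‖ * ‖supL hT‖ * ‖v‖ *
        (‖deriv2 T 0‖ * ‖w‖))) := by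
        refine ((mulL T a).le_opNorm _).trans ?_
        gcongr
        refine (hm _ _).trans ?_
        gcongr
        refine (hm _ _).trans ?_
        gcongr
        exact (deriv2 T 0).le_opNorm w
    _ = _ := by ring

/-- Telescoping one slot at a time, so that each term on the right carries a factor y. -/
lemma trilin_add_diag_sub (hT : 0 < T) (a : Lp ℝ ⊤ (mu T)) (x y : H2 T) :
    trilin hT a (x + y) (x + y) (x + y) - trilin hT a x x x =
      trilin hT a y (x + y) (x + y) + trilin hT a x y (x + y) + trilin hT a x x y := by
  simp only [trilin, map_add, add_apply]
  abel

lemma nonlinOp_eq (hT : 0 < T) (a : Lp ℝ ⊤ (mu T)) (lam : ℝ) (u : H2 T) :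
    nonlinOp a lam u = linOp T lam u + trilin hT a u u u := by
  rw [nonlinOp]
  congr 1
  ext1
  filter_upwards [(memLp_cubic a u).coeFn_toLp, coeFn_trilin hT a u u u] with t h1 h2
  rw [h1, h2]
  ring

/-- Only sums and compositions of bounded (multi)linear maps occur, so every order is allowed, `ω`
included; the implicit function theorem is applied at order `ω`. -/
lemma contDiff_nonlinOp (hT : 0 < T) (a : Lp ℝ ⊤ (mu T)) {n : WithTop ℕ∞} :
    ContDiff ℝ n fun p : ℝ × H2 T => nonlinOp a p.1 p.2 := by
  simp only [nonlinOp_eq hT, linOp, trilin, add_apply, smul_apply]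
  have h0 : ContDiff ℝ n fun p : ℝ × H2 T => deriv2 T 0 p.2 :=
    (deriv2 T 0).contDiff.comp contDiff_snd
  have h2 : ContDiff ℝ n fun p : ℝ × H2 T => deriv2 T 2 p.2 :=
    (deriv2 T 2).contDiff.comp contDiff_snd
  have hs : ContDiff ℝ n fun p : ℝ × H2 T => mulL T (supL hT p.2) :=
    ((mulL T).comp (supL hT)).contDiff.comp contDiff_snd
  exact (h2.add (contDiff_fst.smul h0)).add
    ((mulL T a).contDiff.comp (hs.clm_apply (hs.clm_apply h0)))

end Cubic

/-! ### The Fredholm alternative for 𝔏(σ_k) -/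

section Linear

variable {T : ℝ} {k : ℕ}

lemma inner_deriv2_modes (hT : 0 < T) (u : H2 T) :
    inner ℝ (deriv2 T 2 u) (cosL2 T k) = -sigma T k * inner ℝ (deriv2 T 0 u) (cosL2 T k) ∧
    inner ℝ (deriv2 T 2 u) (sinL2 T k) = -sigma T k * inner ℝ (deriv2 T 0 u) (sinL2 T k) ∧
    inner ℝ (deriv2 T 1 u) (cosL2 T k) =
      (2 * Real.pi * k / T) * inner ℝ (deriv2 T 0 u) (sinL2 T k) ∧
    inner ℝ (deriv2 T 1 u) (sinL2 T k) =
      -(2 * Real.pi * k / T) * inner ℝ (deriv2 T 0 u) (cosL2 T k) := by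
  have h1 : IsPeriodicDeriv (deriv2 T 0 u) (deriv2 T 1 u) := u.2.1
  have h2 : IsPeriodicDeriv (deriv2 T 1 u) (deriv2 T 2 u) := u.2.2
  have a1 := h1.inner_add_inner hT.le (isPeriodicDeriv_cos T k)
  have a2 := h2.inner_add_inner hT.le (isPeriodicDeriv_cos T k)
  have b1 := h1.inner_add_inner hT.le (isPeriodicDeriv_sin T k)
  have b2 := h2.inner_add_inner hT.le (isPeriodicDeriv_sin T k)
  rw [inner_smul_right] at a1 a2 b1 b2
  rw [sigma]
  refine ⟨?_, ?_, ?_, ?_⟩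
  · linear_combination a2 + (2 * Real.pi * k / T) * b1
  · linear_combination b2 - (2 * Real.pi * k / T) * a1
  · linear_combination a1
  · linear_combination b1

lemma inner_linOp_modes (hT : 0 < T) (lam : ℝ) (u : H2 T) :
    inner ℝ (linOp T lam u) (cosL2 T k) = (lam - sigma T k) * inner ℝ (deriv2 T 0 u) (cosL2 T k) ∧
    inner ℝ (linOp T lam u) (sinL2 T k) =
      (lam - sigma T k) * inner ℝ (deriv2 T 0 u) (sinL2 T k) := by
  obtain ⟨h1, h2, -, -⟩ := inner_deriv2_modes (k := k) hT u
  simp only [linOp, add_apply, smul_apply, inner_add_left, inner_smul_left, h1, h2, conj_trivial]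
  constructor <;> ring

lemma inner_H2_eq (u v : H2 T) :
    inner ℝ u v = inner ℝ (deriv2 T 0 u) (deriv2 T 0 v) + inner ℝ (deriv2 T 1 u) (deriv2 T 1 v) +
      inner ℝ (deriv2 T 2 u) (deriv2 T 2 v) := by
  rw [Submodule.coe_inner, PiLp.inner_apply, Fin.sum_univ_three]
  rfl

/-- Moving the derivatives onto a mode by parts shows that its H² product with y is 1 + σ_k + σ_k²
times its L² product, and this factor is positive. -/
lemma inner_modes_of_mem_orthogonal (hT : 0 < T) {y : H2 T} (hy : y ∈ (kernel T k)ᗮ) :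
    inner ℝ (deriv2 T 0 y) (cosL2 T k) = 0 ∧ inner ℝ (deriv2 T 0 y) (sinL2 T k) = 0 := by
  obtain ⟨h1, h2, h3, h4⟩ := inner_deriv2_modes (k := k) hT y
  have hpos : 1 + sigma T k + sigma T k ^ 2 ≠ 0 := by
    have : 0 ≤ sigma T k := sq_nonneg _
    positivity
  have hc := (Submodule.mem_orthogonal' _ _).1 hy _ (cosH2_mem T k)
  have hs := (Submodule.mem_orthogonal' _ _).1 hy _ (sinH2_mem T k)
  rw [inner_H2_eq] at hc hs
  change inner ℝ (deriv2 T 0 y) (cosL2 T k) +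
    inner ℝ (deriv2 T 1 y) ((-(2 * Real.pi * k / T)) • sinL2 T k) +
    inner ℝ (deriv2 T 2 y) ((-sigma T k) • cosL2 T k) = 0 at hc
  change inner ℝ (deriv2 T 0 y) (sinL2 T k) +
    inner ℝ (deriv2 T 1 y) ((2 * Real.pi * k / T) • cosL2 T k) +
    inner ℝ (deriv2 T 2 y) ((-sigma T k) • sinL2 T k) = 0 at hs
  rw [inner_smul_right, inner_smul_right, h1, h4] at hc
  rw [inner_smul_right, inner_smul_right, h2, h3] at hs
  constructor
  · refine (mul_eq_zero.1 (?_ : (1 + sigma T k + sigma T k ^ 2) * _ = 0)).resolve_left hpos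
    rw [← hc, sigma]
    ring
  · refine (mul_eq_zero.1 (?_ : (1 + sigma T k + sigma T k ^ 2) * _ = 0)).resolve_left hpos
    rw [← hs, sigma]
    ring

/-- Variation of parameters: `u'' + σ_k u = f` has a periodic solution if `f` is orthogonal to the
two modes of frequency `k`. -/
lemma exists_linOp_eq (hT : 0 < T) (hk : 1 ≤ k) {f : L2 T} (hfc : inner ℝ f (cosL2 T k) = 0)
    (hfs : inner ℝ f (sinL2 T k) = 0) : ∃ u : H2 T, linOp T (sigma T k) u = f := by
  have hw := frequency_pos hT hk
  obtain ⟨hcT, hsT⟩ := angle_period T k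
  have hσ : sigma T k = (2 * Real.pi * k / T) ^ 2 := rfl
  have hr : √(2 / T) ≠ 0 := (Real.sqrt_pos.2 (by positivity)).ne'
  rw [cosL2, inner_ofCont_right hT.le] at hfc
  rw [sinL2, inner_ofCont_right hT.le] at hfs
  simp only [cosMode, sinMode, mul_left_comm _ (√(2 / T)), intervalIntegral.integral_const_mul,
    mul_eq_zero, hr, false_or] at hfc hfs
  rw [hσ]
  generalize 2 * Real.pi * k / T = w at *
  have hS : ∀ t, HasDerivAt (fun s => Real.sin (w * s)) (w * Real.cos (w * t)) t := fun t => by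
    simpa [mul_comm] using ((hasDerivAt_id t).const_mul w).sin
  have hC : ∀ t, HasDerivAt (fun s => Real.cos (w * s)) (-(w * Real.sin (w * t))) t := fun t => by
    simpa [mul_comm] using ((hasDerivAt_id t).const_mul w).cos
  have hf0 := fun {t : ℝ} (ht : t ∈ Icc 0 T) => intervalIntegrable_L2 f ht
  have hfc_int : ∀ t ∈ Icc 0 T,
      IntervalIntegrable (fun s => f s * Real.cos (w * s)) volume 0 t := fun t ht =>
    (hf0 ht).mul_continuousOn (by fun_prop)
  have hfs_int : ∀ t ∈ Icc 0 T,
      IntervalIntegrable (fun s => f s * Real.sin (w * s)) volume 0 t := fun t ht =>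
    (hf0 ht).mul_continuousOn (by fun_prop)
  have hTm : T ∈ Icc 0 T := ⟨hT.le, le_rfl⟩
  set A : ℝ → ℝ := fun t => ∫ s in (0 : ℝ)..t, f s * Real.cos (w * s) with hA
  set B : ℝ → ℝ := fun t => ∫ s in (0 : ℝ)..t, f s * Real.sin (w * s) with hB
  have hAc : ContinuousOn A (Icc 0 T) := continuousOn_primitive hT.le (hfc_int T hTm)
  have hBc : ContinuousOn B (Icc 0 T) := continuousOn_primitive hT.le (hfs_int T hTm)
  have hA0 : A 0 = 0 := by simp [hA]
  have hB0 : B 0 = 0 := by simp [hB]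
  have hAT : A T = 0 := hfc
  have hBT : B T = 0 := hfs
  -- This is the Duhamel integral of w⁻¹ sin(w(t - s)) f(s), the solution with zero initial data,
  -- and p is its derivative. Orthogonality of f to the modes says A T = B T = 0, so u and p vanish
  -- at T as well and are periodic.
  set u : ℝ → ℝ := fun t => w⁻¹ * (Real.sin (w * t) * A t - Real.cos (w * t) * B t) with hu
  set p : ℝ → ℝ := fun t => Real.cos (w * t) * A t + Real.sin (w * t) * B t with hp
  have huc : ContinuousOn u (Icc 0 T) := by
    have : Continuous fun t => Real.sin (w * t) := by fun_prop
    have : Continuous fun t => Real.cos (w * t) := by fun_prop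
    fun_prop
  have hpc : ContinuousOn p (Icc 0 T) := by
    have : Continuous fun t => Real.sin (w * t) := by fun_prop
    have : Continuous fun t => Real.cos (w * t) := by fun_prop
    fun_prop
  have hint : ∀ {g g' h : ℝ → ℝ} {t : ℝ}, t ∈ Icc 0 T → Continuous g' → Continuous g →
      (∀ t ∈ Icc 0 T, IntervalIntegrable h volume 0 t) →
      IntervalIntegrable (fun s => g' s * (∫ r in (0 : ℝ)..s, h r) + g s * h s) volume 0 t := by
    intro g g' h t ht hg' hg hh
    refine IntervalIntegrable.add ?_ ((hh t ht).continuousOn_mul hg.continuousOn)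
    refine ContinuousOn.intervalIntegrable ?_
    rw [uIcc_of_le ht.1]
    exact hg'.continuousOn.mul (continuousOn_primitive ht.1 (hh t ht))
  have hup : ∀ t ∈ Icc 0 T, u t = ∫ s in (0 : ℝ)..t, p s := by
    intro t ht
    simp only [hu]
    rw [mul_primitive_eq hS (by fun_prop) (hfc_int t ht),
      mul_primitive_eq hC (by fun_prop) (hfs_int t ht), ← intervalIntegral.integral_sub
        (hint ht (by fun_prop) (by fun_prop) hfc_int) (hint ht (by fun_prop) (by fun_prop) hfs_int),
      ← intervalIntegral.integral_const_mul]
    refine intervalIntegral.integral_congr fun s _ => ?_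
    simp only [hp, hA, hB]
    field_simp
    ring
  have hpu : ∀ t ∈ Icc 0 T, p t = ∫ s in (0 : ℝ)..t, (f s - w ^ 2 * u s) := by
    intro t ht
    simp only [hp]
    rw [mul_primitive_eq hC (by fun_prop) (hfc_int t ht),
      mul_primitive_eq hS (by fun_prop) (hfs_int t ht), ← intervalIntegral.integral_add
        (hint ht (by fun_prop) (by fun_prop) hfc_int) (hint ht (by fun_prop) (by fun_prop) hfs_int)]
    refine intervalIntegral.integral_congr fun s _ => ?_
    simp only [hu, hA, hB]
    field_simp
    linear_combination f s * Real.sin_sq_add_cos_sq (w * s)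
  set U : L2 T := (memLp_of_continuousOn huc).toLp with hU
  set P : L2 T := (memLp_of_continuousOn hpc).toLp with hP
  have hUu : U =ᵐ[mu T] u := MemLp.coeFn_toLp _
  have hPp : P =ᵐ[mu T] p := MemLp.coeFn_toLp _
  have hF : ((f - w ^ 2 • U : L2 T) : ℝ → ℝ) =ᵐ[mu T] fun s => f s - w ^ 2 * u s := by
    filter_upwards [Lp.coeFn_sub f (w ^ 2 • U), Lp.coeFn_smul (w ^ 2) U, hUu] with t h1 h2 h3
    rw [h1, Pi.sub_apply, h2, Pi.smul_apply, h3, smul_eq_mul]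
  have hu0 : u 0 = 0 := by simp [hu, hA0, hB0]
  have hp0 : p 0 = 0 := by simp [hp, hA0, hB0]
  refine ⟨⟨WithLp.toLp 2 ![U, P, f - w ^ 2 • U], ⟨u, hUu, fun t ht => ?_, ?_⟩,
    ⟨p, hPp, fun t ht => ?_, ?_⟩⟩, ?_⟩
  · rw [hu0, zero_add, hup t ht]
    exact (intervalIntegral_congr_L2 hPp ht).symm
  · simp [hu, hA0, hB0, hAT, hBT]
  · rw [hp0, zero_add, hpu t ht]
    exact (intervalIntegral_congr_L2 hF ht).symm
  · simp [hp, hA0, hB0, hAT, hBT]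
  · change (f - w ^ 2 • U) + w ^ 2 • U = f
    exact sub_add_cancel _ _

end Linear

/-! ### The abstract Lyapunov–Schmidt step -/

section LyapunovSchmidt

variable {H F : Type*} [NormedAddCommGroup H] [InnerProductSpace ℝ H] [CompleteSpace H]
  [NormedAddCommGroup F] [NormedSpace ℝ F] [CompleteSpace F]

lemma isInvertible_comp_subtypeL (K : Submodule ℝ H) (A : H →L[ℝ] F)
    (hA : Function.Bijective fun y : Kᗮ => A y) : (A ∘L Kᗮ.subtypeL).IsInvertible :=
  ⟨ContinuousLinearEquiv.ofBijective (A ∘L Kᗮ.subtypeL) (LinearMap.ker_eq_bot.2 hA.1)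
    (LinearMap.range_eq_top.2 hA.2), ContinuousLinearEquiv.coe_ofBijective _ _ _⟩

/-- By the open mapping theorem the inverse is bounded, and its norm serves as C. -/
lemma exists_norm_le_of_bijective (K : Submodule ℝ H) (A : H →L[ℝ] F)
    (hA : Function.Bijective fun y : Kᗮ => A y) :
    ∃ C, 0 ≤ C ∧ ∀ y ∈ Kᗮ, ‖y‖ ≤ C * ‖A y‖ := by
  obtain ⟨e, he⟩ := isInvertible_comp_subtypeL K A hA
  refine ⟨‖(e.symm : F →L[ℝ] Kᗮ)‖, ContinuousLinearMap.opNorm_nonneg _, fun y hy => ?_⟩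
  have h := (e.symm : F →L[ℝ] Kᗮ).le_opNorm (e ⟨y, hy⟩)
  have hy' : e ⟨y, hy⟩ = A y := by
    change (e : Kᗮ →L[ℝ] F) ⟨y, hy⟩ = A y
    rw [he]
    rfl
  rw [← hy']
  simpa using h

/-- The implicit function theorem for the equation `G (lam, x + y) = 0`, to be solved for
`y ∈ Kᗮ` as a function of `lam` and `x ∈ K`. -/
theorem exists_implicit_orthogonal (K : Submodule ℝ H) (hK : IsClosed (K : Set H))
    {G : ℝ × H → F} (hG : ContDiff ℝ ω G) {σ : ℝ} {A : H →L[ℝ] F}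
    (hGA : HasFDerivAt (fun u => G (σ, u)) A 0) (hG0 : G (σ, 0) = 0)
    (hA : Function.Bijective fun y : Kᗮ => A y) :
    ∃ (I : Set ℝ) (N : Set K) (ψ : ℝ × K → Kᗮ), (IsOpen I ∧ σ ∈ I ∧ IsOpen N ∧ 0 ∈ N ∧
      ContDiffOn ℝ ∞ ψ (I ×ˢ N) ∧ ψ (σ, 0) = 0 ∧
      ∀ lam ∈ I, ∀ x ∈ N, G (lam, (x : H) + (ψ (lam, x) : H)) = 0) ∧
      ∃ O ∈ 𝓝 ((σ, 0) : ℝ × H), ∀ (lam : ℝ) (x : K) (y : Kᗮ),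
        (lam, (x : H) + (y : H)) ∈ O → G (lam, (x : H) + (y : H)) = 0 →
          lam ∈ I ∧ x ∈ N ∧ y = ψ (lam, x) := by
  have : CompleteSpace K := hK.completeSpace_coe
  set f : (ℝ × K) × Kᗮ → F := fun v => G (v.1.1, (v.1.2 : H) + (v.2 : H)) with hf
  have hfc : ContDiff ℝ ω f := by
    refine hG.comp ?_
    exact (contDiff_fst.comp contDiff_fst).prodMk
      ((K.subtypeL.contDiff.comp (contDiff_snd.comp contDiff_fst)).add
        (Kᗮ.subtypeL.contDiff.comp contDiff_snd))
  have hf0 : f ((σ, 0), 0) = 0 := by simp [hf, hG0]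
  have cdf : ContDiffAt ℝ ω f ((σ, 0), 0) := hfc.contDiffAt
  have hω : (ω : WithTop ℕ∞) ≠ 0 := by simp
  -- The partial derivative in y at the base point is the restriction of A to Kᗮ, by uniqueness of
  -- derivatives.
  have hfd : fderiv ℝ f ((σ, 0), 0) ∘L .inr ℝ (ℝ × K) Kᗮ = A ∘L Kᗮ.subtypeL := by
    have h1 : HasFDerivAt (fun y : Kᗮ => f ((σ, 0), y))
        (fderiv ℝ f ((σ, 0), 0) ∘L .inr ℝ (ℝ × K) Kᗮ) 0 :=
      (cdf.differentiableAt hω).hasFDerivAt.comp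
        (0 : Kᗮ) (hasFDerivAt_prodMk_right (σ, (0 : K)) (0 : Kᗮ))
    have h2 : HasFDerivAt (fun y : Kᗮ => f ((σ, 0), y)) (A ∘L Kᗮ.subtypeL) 0 := by
      have h3 := HasFDerivAt.comp (0 : Kᗮ) (f := Kᗮ.subtypeL) (g := fun u => G (σ, u)) (g' := A)
        (by simpa using hGA) Kᗮ.subtypeL.hasFDerivAt
      refine h3.congr_of_eventuallyEq (Eventually.of_forall fun y => ?_)
      simp [hf]
    exact h1.unique h2
  have hinv : (fderiv ℝ f ((σ, 0), 0) ∘L .inr ℝ (ℝ × K) Kᗮ).IsInvertible := by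
    rw [hfd]
    exact isInvertible_comp_subtypeL K A hA
  have hbase := cdf.implicitFunction_apply_self hω hinv
  have hsolves := cdf.eventually_apply_implicitFunction hω hinv
  have hiff := cdf.eventually_apply_eq_iff_implicitFunction hω hinv
  -- Order `ω` matters here: analyticity at a point persists on a neighbourhood, whereas
  -- `ContDiffAt` of order `∞` at a point need not.
  have hsmooth := (cdf.contDiffAt_implicitFunction hω hinv).eventually (by simp)
  rw [hf0] at hsolves hiff
  set ψ := cdf.implicitFunction hω hinv
  obtain ⟨I, N, hI, hσ, hN, h0, hIN⟩ := mem_nhds_prod_iff'.1 (hsolves.and hsmooth)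
  refine ⟨I, N, ψ, ⟨hI, hσ, hN, h0, fun p hp => ?_, hbase, fun lam hlam x hx => ?_⟩, ?_⟩
  · exact ((hIN hp).2.of_le (by simp)).contDiffWithinAt
  · exact (hIN (Set.mk_mem_prod hlam hx)).1
  -- Local uniqueness is known near the base point of (ℝ × K) × Kᗮ; the orthogonal projections pull
  -- that neighbourhood back to ℝ × H.
  · have htend : Tendsto (fun q : ℝ × H =>
        ((q.1, K.orthogonalProjectionOnto q.2), Kᗮ.orthogonalProjectionOnto q.2)) (𝓝 (σ, 0))
        (𝓝 ((σ, 0), 0)) :=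
      Continuous.tendsto' (by fun_prop) _ _ (by simp)
    have hev : ∀ᶠ v : (ℝ × K) × Kᗮ in 𝓝 ((σ, 0), 0),
        (f v = 0 ↔ ψ v.1 = v.2) ∧ v.1 ∈ I ×ˢ N := by
      refine hiff.and (continuous_fst.continuousAt.eventually ?_)
      exact (hI.prod hN).mem_nhds ⟨hσ, h0⟩
    refine ⟨_, htend.eventually hev, fun lam x y hO haux => ?_⟩
    have hx : K.orthogonalProjectionOnto ((x : H) + y) = x := by
      rw [map_add, Submodule.orthogonalProjectionOnto_mem_subspace_eq_self,
        Submodule.orthogonalProjectionOnto_apply_of_mem_orthogonal y.2, add_zero]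
    have hy : Kᗮ.orthogonalProjectionOnto ((x : H) + y) = y := by
      rw [map_add, Submodule.orthogonalProjectionOnto_mem_subspace_eq_self,
        Submodule.orthogonalProjectionOnto_apply_of_mem_orthogonal
          (Submodule.le_orthogonal_orthogonal _ x.2), zero_add]
    simp only [mem_ofPred_eq, hx, hy] at hO
    exact ⟨hO.2.1, hO.2.2, (hO.1.1 haux).symm⟩

lemma contDiffOn_graph {H : Type*} [NormedAddCommGroup H] [InnerProductSpace ℝ H]
    {K : Submodule ℝ H} {I : Set ℝ} {N : Set K} {ψ : ℝ × K → Kᗮ}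
    (hψ : ContDiffOn ℝ ∞ ψ (I ×ˢ N)) (c s : K) :
    ContDiffOn ℝ ∞ (fun p : ℝ × ℝ × ℝ => (ψ (p.1, p.2.1 • c + p.2.2 • s) : H))
      (I ×ˢ ((fun x : ℝ × ℝ => x.1 • c + x.2 • s) ⁻¹' N)) := by
  have h : ContDiff ℝ ∞ fun p : ℝ × ℝ × ℝ => (p.1, p.2.1 • c + p.2.2 • s) := by fun_prop
  exact Kᗮ.subtypeL.contDiff.comp_contDiffOn
    (hψ.comp h.contDiffOn fun p hp => Set.mk_mem_prod hp.1 hp.2)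

lemma contDiffOn_comp_fst_prod {E F : Type*} [NormedAddCommGroup E] [NormedSpace ℝ E]
    [NormedAddCommGroup F] [NormedSpace ℝ F] {G : ℝ × E → F} {n : WithTop ℕ∞}
    (hG : ContDiff ℝ n G) {s : Set (ℝ × ℝ × ℝ)} {u : ℝ × ℝ × ℝ → E} (hu : ContDiffOn ℝ n u s) :
    ContDiffOn ℝ n (fun p : ℝ × ℝ × ℝ => G (p.1, u p)) s :=
  hG.comp_contDiffOn (contDiff_fst.contDiffOn.prodMk hu)

end LyapunovSchmidt

/-! ### Existence and local uniqueness of the reduction -/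

section Reduction

variable {T : ℝ} {k : ℕ}

/-- `Q_k` as a continuous linear map. -/
def projQL (T : ℝ) (k : ℕ) : L2 T →L[ℝ] L2 T :=
  (innerSL ℝ (cosL2 T k)).smulRight (cosL2 T k) + (innerSL ℝ (sinL2 T k)).smulRight (sinL2 T k)

lemma projQL_apply (v : L2 T) : projQL T k v = projQ T k v := by
  simp [projQL, projQ, real_inner_comm]

lemma projQ_eq_zero {v : L2 T} (hc : inner ℝ v (cosL2 T k) = 0) (hs : inner ℝ v (sinL2 T k) = 0) :
    projQ T k v = 0 := by
  simp [projQ, hc, hs]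

lemma inner_projQ (hT : 0 < T) (hk : 1 ≤ k) (v : L2 T) :
    inner ℝ (projQ T k v) (cosL2 T k) = inner ℝ v (cosL2 T k) ∧
      inner ℝ (projQ T k v) (sinL2 T k) = inner ℝ v (sinL2 T k) := by
  obtain ⟨hcc, hss, hcs⟩ := inner_modes (k := k) hT hk
  have hsc : inner ℝ (sinL2 T k) (cosL2 T k) = 0 := by rw [real_inner_comm]; exact hcs
  simp only [projQ, inner_add_left, inner_smul_left, hcc, hss, hcs, hsc, conj_trivial]
  constructor <;> ring

/-- The orthogonal complement in `L²` of the two modes of frequency `k`, that is, the range of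
`I - Q_k`. -/
abbrev modesPerp (T : ℝ) (k : ℕ) : Submodule ℝ (L2 T) :=
  (Submodule.span ℝ {cosL2 T k, sinL2 T k})ᗮ

lemma mem_modesPerp {v : L2 T} :
    v ∈ modesPerp T k ↔ inner ℝ v (cosL2 T k) = 0 ∧ inner ℝ v (sinL2 T k) = 0 := by
  rw [Submodule.mem_orthogonal']
  constructor
  · intro h
    exact ⟨h _ (Submodule.subset_span (by simp)), h _ (Submodule.subset_span (by simp))⟩
  · rintro ⟨hc, hs⟩ u hu
    obtain ⟨x, y, rfl⟩ := Submodule.mem_span_pair.1 hu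
    rw [inner_add_right, inner_smul_right, inner_smul_right, hc, hs]
    simp

/-- `I - Q_k` as a map onto its range. -/
def complQL (hT : 0 < T) (hk : 1 ≤ k) : L2 T →L[ℝ] modesPerp T k :=
  (ContinuousLinearMap.id ℝ (L2 T) - projQL T k).codRestrict (modesPerp T k) fun v => by
    rw [mem_modesPerp]
    simp [inner_sub_left, projQL_apply, inner_projQ hT hk]

lemma coe_complQL (hT : 0 < T) (hk : 1 ≤ k) (v : L2 T) :
    (complQL hT hk v : L2 T) = v - projQ T k v := by
  simp [complQL, projQL_apply]

/-- The operator `(I - Q_k) 𝔏(σ_k)`. -/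
def auxLin (hT : 0 < T) (hk : 1 ≤ k) : H2 T →L[ℝ] modesPerp T k :=
  complQL hT hk ∘L linOp T (sigma T k)

/-- The range of 𝔏(σ_k) is already orthogonal to the modes, so I - Q_k acts on it as the identity.
-/
lemma coe_auxLin (hT : 0 < T) (hk : 1 ≤ k) (u : H2 T) :
    (auxLin hT hk u : L2 T) = linOp T (sigma T k) u := by
  obtain ⟨h1, h2⟩ := inner_linOp_modes (k := k) hT (sigma T k) u
  rw [sub_self, zero_mul] at h1 h2
  change (complQL hT hk (linOp T (sigma T k) u) : L2 T) = _
  rw [coe_complQL, projQ_eq_zero h1 h2, sub_zero]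

lemma isClosed_kernel (T : ℝ) (k : ℕ) : IsClosed (kernel T k : Set (H2 T)) :=
  (linOp T (sigma T k)).isClosed_ker

/-- Injectivity holds because the kernel meets its orthogonal complement only in 0. For
surjectivity, a solution from `exists_linOp_eq` is corrected by its projection to the kernel. -/
lemma bijective_auxLin (hT : 0 < T) (hk : 1 ≤ k) :
    Function.Bijective fun y : (kernel T k)ᗮ => auxLin hT hk (y : H2 T) := by
  have := completeSpace_H2 hT.le
  have : CompleteSpace (kernel T k) := (isClosed_kernel T k).completeSpace_coe
  constructor
  · intro y z hyz
    have h : (y - z : H2 T) ∈ kernel T k := by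
      change linOp T (sigma T k) (y - z : H2 T) = 0
      rw [← coe_auxLin hT hk, map_sub, sub_eq_zero.2 hyz]
      rfl
    have h0 := (Submodule.mem_orthogonal _ _).1 ((kernel T k)ᗮ.sub_mem y.2 z.2) _ h
    exact Subtype.ext (sub_eq_zero.1 (inner_self_eq_zero.1 h0))
  · intro f
    obtain ⟨hc, hs⟩ := mem_modesPerp.1 f.2
    obtain ⟨u, hu⟩ := exists_linOp_eq hT hk hc hs
    refine ⟨⟨u - (kernel T k).starProjection u,
      Submodule.sub_starProjection_mem_orthogonal u⟩, Subtype.ext ?_⟩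
    have h : linOp T (sigma T k) ((kernel T k).starProjection u) = 0 :=
      Submodule.starProjection_apply_mem (kernel T k) u
    rw [coe_auxLin, map_sub, h, sub_zero, hu]

lemma exists_norm_le_linOp (hT : 0 < T) (hk : 1 ≤ k) :
    ∃ C, 0 ≤ C ∧ ∀ y ∈ (kernel T k)ᗮ, ‖y‖ ≤ C * ‖linOp T (sigma T k) y‖ := by
  have := completeSpace_H2 hT.le
  obtain ⟨C, hC, h⟩ := exists_norm_le_of_bijective _ _ (bijective_auxLin (T := T) hT hk)
  refine ⟨C, hC, fun y hy => ?_⟩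
  rw [← coe_auxLin hT hk]
  exact h y hy

/-- `(I - Q_k) 𝔉` with values in the range of `I - Q_k`. -/
def auxFun (hT : 0 < T) (hk : 1 ≤ k) (a : Lp ℝ ⊤ (mu T)) (p : ℝ × H2 T) : modesPerp T k :=
  complQL hT hk (nonlinOp a p.1 p.2)

lemma auxFun_eq_zero_iff (hT : 0 < T) (hk : 1 ≤ k) (a : Lp ℝ ⊤ (mu T)) (lam : ℝ)
    (x : kernel T k) (y : (kernel T k)ᗮ) :
    auxFun hT hk a (lam, (x : H2 T) + (y : H2 T)) = 0 ↔ auxMap a k lam x y = 0 := by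
  rw [← Subtype.coe_inj, auxFun, coe_complQL, auxMap]
  rfl

/-- The cubic term is O(‖u‖³), so it does not contribute to the derivative at 0. -/
lemma hasFDerivAt_auxFun (hT : 0 < T) (hk : 1 ≤ k) (a : Lp ℝ ⊤ (mu T)) :
    HasFDerivAt (fun u => auxFun hT hk a (sigma T k, u)) (auxLin hT hk) 0 := by
  have h2 : HasFDerivAt (fun u : H2 T => complQL hT hk (trilin hT a u u u))
      (0 : H2 T →L[ℝ] modesPerp T k) 0 := by
    obtain ⟨C, hC, hb⟩ := exists_norm_trilin_le hT a
    refine IsBigO.hasFDerivAt (n := 3) (𝕜 := ℝ) ?_ (by norm_num)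
    refine IsBigO.of_bound (‖complQL hT hk‖ * C) (Eventually.of_forall fun y => ?_)
    refine ((complQL hT hk).le_opNorm _).trans ?_
    rw [mul_assoc]
    refine mul_le_mul_of_nonneg_left ((hb _ _ _).trans (le_of_eq ?_)) (norm_nonneg _)
    rw [sub_zero, norm_pow, norm_norm]
    ring
  have h3 := ((auxLin (T := T) hT hk).hasFDerivAt (x := 0)).add h2
  rw [add_zero] at h3
  refine h3.congr_of_eventuallyEq (Eventually.of_forall fun y => ?_)
  simp [auxFun, auxLin, nonlinOp_eq hT]

lemma exists_isReduction (hT : 0 < T) (hk : 1 ≤ k) (a : Lp ℝ ⊤ (mu T)) :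
    ∃ (I : Set ℝ) (N : Set (kernel T k)) (ψ : ℝ × kernel T k → (kernel T k)ᗮ),
      IsReduction a k I N ψ ∧
      ∃ O ∈ 𝓝 ((sigma T k, 0) : ℝ × H2 T), ∀ (lam : ℝ) (x : kernel T k) (y : (kernel T k)ᗮ),
        (lam, (x : H2 T) + (y : H2 T)) ∈ O → auxMap a k lam x y = 0 →
          lam ∈ I ∧ x ∈ N ∧ y = ψ (lam, x) := by
  have := completeSpace_H2 hT.le
  obtain ⟨I, N, ψ, ⟨hI, hσ, hN, h0, hψ, hb, hs⟩, O, hO, hu⟩ :=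
    exists_implicit_orthogonal (kernel T k) (isClosed_kernel T k)
      (G := auxFun hT hk a) ((complQL hT hk).contDiff.comp (contDiff_nonlinOp hT a))
      (hasFDerivAt_auxFun hT hk a) (by simp [auxFun, nonlinOp_eq hT, trilin])
      (bijective_auxLin hT hk)
  simp only [auxFun_eq_zero_iff] at hs hu
  exact ⟨I, N, ψ, ⟨hI, hσ, hN, h0, hψ, hb, hs⟩, O, hO, hu⟩

end Reduction

/-! ### Size of ψ and expansion of the reduced map -/

section Expansion

variable {T : ℝ} {k : ℕ}

lemma coe_coordMap (x : ℝ × ℝ) :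
    (coordMap T k x : H2 T) = x.1 • cosH2 T k + x.2 • sinH2 T k := rfl

lemma deriv2_coordMap (x : ℝ × ℝ) :
    deriv2 T 0 (coordMap T k x : H2 T) = x.1 • cosL2 T k + x.2 • sinL2 T k := rfl

lemma linOp_coordMap (lam : ℝ) (x : ℝ × ℝ) :
    linOp T lam (coordMap T k x : H2 T) =
      (lam - sigma T k) • (x.1 • cosL2 T k + x.2 • sinL2 T k) := by
  have h : linOp T (sigma T k) (coordMap T k x : H2 T) = 0 := (coordMap T k x).2
  have h' : linOp T lam (coordMap T k x : H2 T) = linOp T (sigma T k) (coordMap T k x : H2 T) +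
      (lam - sigma T k) • deriv2 T 0 (coordMap T k x : H2 T) := by
    simp only [linOp, add_apply, smul_apply, sub_smul]
    abel
  rw [h', h, zero_add, deriv2_coordMap]

lemma complQL_modes (hT : 0 < T) (hk : 1 ≤ k) (x : ℝ × ℝ) :
    complQL hT hk (x.1 • cosL2 T k + x.2 • sinL2 T k) = 0 := by
  obtain ⟨hcc, hss, hcs⟩ := inner_modes (k := k) hT hk
  have hsc : inner ℝ (sinL2 T k) (cosL2 T k) = 0 := by rw [real_inner_comm]; exact hcs
  apply Subtype.ext
  rw [coe_complQL]
  simp only [projQ, inner_add_left, inner_smul_left, hcc, hss, hcs, hsc, conj_trivial]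
  simp

lemma exists_norm_coordMap_le (T : ℝ) (k : ℕ) :
    ∃ M, 0 ≤ M ∧ ∀ x : ℝ × ℝ, ‖(coordMap T k x : H2 T)‖ ≤ M * ‖x‖ := by
  refine ⟨‖cosH2 T k‖ + ‖sinH2 T k‖, by positivity, fun x => ?_⟩
  rw [coe_coordMap]
  refine (norm_add_le _ _).trans ?_
  rw [norm_smul, norm_smul, add_mul, mul_comm, mul_comm ‖x.2‖]
  gcongr
  · exact norm_fst_le x
  · exact norm_snd_le x

/-- A definite seminorm on `ℝ²` dominates the sup norm. -/
lemma exists_norm_le_of_definite (nrm : Seminorm ℝ (ℝ × ℝ)) (h : ∀ x, nrm x = 0 → x = 0) :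
    ∃ C, 0 ≤ C ∧ ∀ x, ‖x‖ ≤ C * nrm x := by
  have hb : ∀ x, nrm x ≤ (nrm (1, 0) + nrm (0, 1)) * ‖x‖ := fun x => by
    have hx : x = x.1 • (1, 0) + x.2 • (0, 1) := by ext <;> simp
    calc nrm x = nrm (x.1 • (1, 0) + x.2 • (0, 1)) := by rw [← hx]
      _ ≤ nrm (x.1 • (1, 0)) + nrm (x.2 • (0, 1)) := map_add_le_add _ _ _
      _ ≤ (nrm (1, 0) + nrm (0, 1)) * ‖x‖ := by
        rw [map_smul_eq_mul, map_smul_eq_mul, add_mul, mul_comm, mul_comm ‖x.2‖]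
        exact add_le_add (mul_le_mul_of_nonneg_left (norm_fst_le x) (apply_nonneg _ _))
          (mul_le_mul_of_nonneg_left (norm_snd_le x) (apply_nonneg _ _))
  have hc : Continuous nrm := by
    have hl : LipschitzWith (nrm (1, 0) + nrm (0, 1)).toNNReal nrm := by
      refine LipschitzWith.of_dist_le' fun x y => ?_
      rw [Real.dist_eq, dist_eq_norm]
      exact (abs_sub_map_le_sub nrm x y).trans (hb _)
    exact hl.continuous
  -- The constant is the inverse of the minimum of `nrm` on the compact unit sphere, which is
  -- positive by definiteness.
  obtain ⟨z, hz, hmin⟩ := (isCompact_sphere (0 : ℝ × ℝ) 1).exists_isMinOn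
    ⟨(1, 0), by simp [Prod.norm_def]⟩ hc.continuousOn
  have hz1 : ‖z‖ = 1 := by simpa using hz
  have hpos : 0 < nrm z := by
    refine (apply_nonneg nrm z).lt_of_ne fun h0 => ?_
    rw [h z h0.symm, norm_zero] at hz1
    exact zero_ne_one hz1
  refine ⟨(nrm z)⁻¹, by positivity, fun x => ?_⟩
  rcases eq_or_ne x 0 with rfl | hx
  · simp
  have hxn : 0 < ‖x‖ := norm_pos_iff.2 hx
  have h1 : nrm z ≤ nrm (‖x‖⁻¹ • x) := hmin (by simp [norm_smul, hxn.ne'])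
  rw [map_smul_eq_mul, norm_inv, norm_norm] at h1
  rw [← div_eq_inv_mul, le_div_iff₀ hpos, mul_comm]
  rwa [← div_eq_inv_mul, le_div_iff₀ hxn] at h1

/-- Applied with m = ‖x‖ and n = ‖ψ‖. Since (m + n)³ ≤ 4 (m³ + n³), the smallness conditions turn
the hypothesis into n ≤ n/4 + 4βm³ + n/4, and half of n is absorbed. -/
lemma le_of_cubic_bound {m n α β : ℝ} (hm : 0 ≤ m) (hn : 0 ≤ n) (hβ : 0 ≤ β) (hα : α ≤ 1 / 4)
    (hβn : β * n ^ 2 ≤ 1 / 16) (h : n ≤ α * n + β * (m + n) ^ 3) : n ≤ 8 * β * m ^ 3 := by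
  have h1 : (m + n) ^ 3 ≤ 4 * (m ^ 3 + n ^ 3) := by
    nlinarith [mul_nonneg (add_nonneg hm hn) (sq_nonneg (m - n))]
  have h2 := mul_le_mul_of_nonneg_left h1 hβ
  have h3 := mul_le_mul_of_nonneg_right hα hn
  have h4 := mul_le_mul_of_nonneg_right hβn hn
  nlinarith

section Bounds

variable {a : Lp ℝ ⊤ (mu T)} {I : Set ℝ} {N : Set (kernel T k)}
  {ψ : ℝ × kernel T k → (kernel T k)ᗮ}

lemma continuous_coordMap (T : ℝ) (k : ℕ) : Continuous (coordMap T k) := by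
  unfold coordMap
  fun_prop

lemma coordMap_zero (T : ℝ) (k : ℕ) : coordMap T k 0 = 0 := by simp [coordMap]

lemma IsReduction.mem_nhds (h : IsReduction a k I N ψ) :
    I ×ˢ (coordMap T k ⁻¹' N) ∈ 𝓝 (sigma T k, (0 : ℝ × ℝ)) := by
  refine (h.isOpen_I.prod (h.isOpen_N.preimage (continuous_coordMap T k))).mem_nhds
    ⟨h.mem_I, ?_⟩
  simp only [mem_preimage, coordMap_zero]
  exact h.zero_mem_N

lemma IsReduction.contDiffOn_comp (h : IsReduction a k I N ψ) :
    ContDiffOn ℝ ∞ (fun p : ℝ × ℝ × ℝ => (ψ (p.1, coordMap T k p.2) : H2 T))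
      (I ×ˢ (coordMap T k ⁻¹' N)) :=
  contDiffOn_graph h.smooth _ _

lemma IsReduction.tendsto_zero (h : IsReduction a k I N ψ) :
    Tendsto (fun p : ℝ × ℝ × ℝ => (ψ (p.1, coordMap T k p.2) : H2 T))
      (𝓝 (sigma T k, (0 : ℝ × ℝ))) (𝓝 0) := by
  have := (h.contDiffOn_comp.continuousOn.continuousAt h.mem_nhds).tendsto
  rwa [coordMap_zero, h.base] at this

/-- The solution of the auxiliary equation is of third order in `x`. -/
lemma IsReduction.exists_norm_le (hT : 0 < T) (hk : 1 ≤ k) (h : IsReduction a k I N ψ) :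
    ∃ C, 0 ≤ C ∧ ∀ᶠ p : ℝ × ℝ × ℝ in 𝓝 (sigma T k, (0 : ℝ × ℝ)),
      ‖(ψ (p.1, coordMap T k p.2) : H2 T)‖ ≤ C * ‖(coordMap T k p.2 : H2 T)‖ ^ 3 := by
  obtain ⟨K, hK, hKb⟩ := exists_norm_le_linOp (T := T) hT hk
  obtain ⟨Ct, hCt, ht⟩ := exists_norm_trilin_le hT a
  set B := ‖complQL (T := T) hT hk‖ with hB
  have hB0 : 0 ≤ B := ContinuousLinearMap.opNorm_nonneg _
  set D := ‖deriv2 T 0‖ with hD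
  have hD0 : 0 ≤ D := ContinuousLinearMap.opNorm_nonneg _
  set β := K * (B * Ct) with hβ
  refine ⟨8 * β, by positivity, ?_⟩
  have e1 : ∀ᶠ p : ℝ × ℝ × ℝ in 𝓝 (sigma T k, (0 : ℝ × ℝ)),
      K * (B * (|p.1 - sigma T k| * D)) < 1 / 4 := by
    refine Tendsto.eventually_lt_const (by norm_num : (0 : ℝ) < 1 / 4) ?_
    exact Continuous.tendsto' (by fun_prop) _ _ (by simp)
  have e2 : ∀ᶠ p : ℝ × ℝ × ℝ in 𝓝 (sigma T k, (0 : ℝ × ℝ)),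
      β * ‖(ψ (p.1, coordMap T k p.2) : H2 T)‖ ^ 2 < 1 / 16 := by
    refine Tendsto.eventually_lt_const (by norm_num : (0 : ℝ) < 1 / 16) ?_
    simpa using ((h.tendsto_zero.norm).pow 2).const_mul β
  filter_upwards [e1, e2, h.mem_nhds] with p h1 h2 h3
  have haux := h.solves p.1 h3.1 _ h3.2
  -- The contribution of 𝔏(lam) x disappears: it is a combination of the modes, which I - Q_k
  -- annihilates.
  rw [← auxFun_eq_zero_iff hT hk, auxFun, nonlinOp_eq hT, map_add, map_add, map_add,
    linOp_coordMap, map_smul, complQL_modes, smul_zero, zero_add] at haux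
  have hy : (ψ (p.1, coordMap T k p.2) : H2 T) ∈ (kernel T k)ᗮ := (ψ _).2
  generalize (ψ (p.1, coordMap T k p.2) : H2 T) = y at *
  generalize (coordMap T k p.2 : H2 T) = x at *
  have hlin : linOp T p.1 y = linOp T (sigma T k) y + (p.1 - sigma T k) • deriv2 T 0 y := by
    simp only [linOp, add_apply, smul_apply, sub_smul]
    abel
  -- The auxiliary equation solved for its invertible part; the bound on the inverse then puts ‖y‖
  -- in the form required by `le_of_cubic_bound`.
  have hA : auxLin hT hk y =
      -complQL hT hk ((p.1 - sigma T k) • deriv2 T 0 y + trilin hT a (x + y) (x + y) (x + y)) := by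
    rw [hlin, map_add] at haux
    rw [map_add, eq_neg_iff_add_eq_zero, ← haux, add_assoc]
    rfl
  have hnorm : ‖linOp T (sigma T k) y‖ ≤ B * (|p.1 - sigma T k| * (D * ‖y‖) +
      Ct * (‖x‖ + ‖y‖) ^ 3) := by
    rw [← coe_auxLin hT hk, Submodule.norm_coe, hA, norm_neg]
    refine ((complQL hT hk).le_opNorm _).trans ?_
    refine mul_le_mul_of_nonneg_left ((norm_add_le _ _).trans (add_le_add ?_ ?_)) hB0
    · rw [norm_smul, Real.norm_eq_abs]
      exact mul_le_mul_of_nonneg_left ((deriv2 T 0).le_opNorm y) (abs_nonneg _)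
    · refine (ht _ _ _).trans (mul_le_mul_of_nonneg_left ?_ hCt)
      calc ‖x + y‖ * ‖x + y‖ * ‖x + y‖ = ‖x + y‖ ^ 3 := by ring
        _ ≤ _ := by gcongr; exact norm_add_le _ _
  refine le_of_cubic_bound (norm_nonneg _) (norm_nonneg _) (by positivity) h1.le h2.le ?_
  refine (hKb y hy).trans ((mul_le_mul_of_nonneg_left hnorm hK).trans (le_of_eq ?_))
  rw [hβ]
  ring

/-- Each telescoped term has one factor ψ = O(‖x‖³) and two factors O(‖x‖), so the difference is of
order five; order four is enough and follows from ‖x‖ ≤ 1. -/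
lemma IsReduction.exists_trilin_sub_le (hT : 0 < T) (hk : 1 ≤ k) (h : IsReduction a k I N ψ) :
    ∃ C, ∀ᶠ p : ℝ × ℝ × ℝ in 𝓝 (sigma T k, (0 : ℝ × ℝ)), ∀ u x : H2 T,
      x = coordMap T k p.2 → u = x + ψ (p.1, coordMap T k p.2) →
      ‖trilin hT a u u u - trilin hT a x x x‖ ≤ C * ‖p.2‖ ^ 4 := by
  obtain ⟨C, hC, hψ⟩ := h.exists_norm_le hT hk
  obtain ⟨Ct, hCt, ht⟩ := exists_norm_trilin_le hT a
  obtain ⟨M, hM, hX⟩ := exists_norm_coordMap_le T k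
  refine ⟨Ct * C * ((1 + C) ^ 2 + (1 + C) + 1) * M ^ 4, ?_⟩
  have e1 : ∀ᶠ p : ℝ × ℝ × ℝ in 𝓝 (sigma T k, (0 : ℝ × ℝ)), M * ‖p.2‖ < 1 := by
    refine Tendsto.eventually_lt_const (by norm_num : (0 : ℝ) < 1) ?_
    exact Continuous.tendsto' (by fun_prop) _ _ (by simp)
  filter_upwards [hψ, e1] with p h1 h2
  rintro u x rfl rfl
  have hx := hX p.2
  generalize (ψ (p.1, coordMap T k p.2) : H2 T) = y at *
  generalize (coordMap T k p.2 : H2 T) = x at *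
  have hx1 : ‖x‖ ≤ 1 := hx.trans h2.le
  have hxy : ‖x + y‖ ≤ (1 + C) * ‖x‖ := by
    refine (norm_add_le _ _).trans ?_
    have : ‖x‖ ^ 3 ≤ ‖x‖ := pow_le_of_le_one (norm_nonneg _) hx1 (by norm_num)
    have := mul_le_mul_of_nonneg_left this hC
    linarith
  have hx5 : ‖x‖ ^ 5 ≤ ‖x‖ ^ 4 := pow_le_pow_of_le_one (norm_nonneg _) hx1 (by norm_num)
  rw [trilin_add_diag_sub]
  calc _ ≤ Ct * (‖y‖ * ‖x + y‖ * ‖x + y‖) + Ct * (‖x‖ * ‖y‖ * ‖x + y‖) +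
        Ct * (‖x‖ * ‖x‖ * ‖y‖) :=
        norm_add₃_le.trans (add_le_add_three (ht _ _ _) (ht _ _ _) (ht _ _ _))
    _ ≤ Ct * (C * ‖x‖ ^ 3 * ((1 + C) * ‖x‖) * ((1 + C) * ‖x‖)) +
        Ct * (‖x‖ * (C * ‖x‖ ^ 3) * ((1 + C) * ‖x‖)) + Ct * (‖x‖ * ‖x‖ * (C * ‖x‖ ^ 3)) := by
        gcongr
    _ = Ct * C * ((1 + C) ^ 2 + (1 + C) + 1) * ‖x‖ ^ 5 := by ring
    _ ≤ Ct * C * ((1 + C) ^ 2 + (1 + C) + 1) * (M * ‖p.2‖) ^ 4 := by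
        gcongr
        exact hx5.trans (by gcongr)
    _ = _ := by ring

/-- The linear part leaves no error: y is L²-orthogonal to the modes, and so is 𝔏(lam) y. -/
lemma inner_nonlinOp_modes (hT : 0 < T) (hk : 1 ≤ k) (lam : ℝ) (x : ℝ × ℝ) {y : H2 T}
    (hy : y ∈ (kernel T k)ᗮ) :
    inner ℝ (nonlinOp a lam (coordMap T k x + y)) (cosL2 T k) = (lam - sigma T k) * x.1 +
      inner ℝ (trilin hT a (coordMap T k x + y) (coordMap T k x + y) (coordMap T k x + y))
        (cosL2 T k) ∧
    inner ℝ (nonlinOp a lam (coordMap T k x + y)) (sinL2 T k) = (lam - sigma T k) * x.2 +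
      inner ℝ (trilin hT a (coordMap T k x + y) (coordMap T k x + y) (coordMap T k x + y))
        (sinL2 T k) := by
  obtain ⟨h1, h2⟩ := inner_linOp_modes (k := k) hT lam y
  obtain ⟨h3, h4⟩ := inner_modes_of_mem_orthogonal hT hy
  rw [h3, mul_zero] at h1
  rw [h4, mul_zero] at h2
  obtain ⟨hcc, hss, hcs⟩ := inner_modes (k := k) hT hk
  have hsc : inner ℝ (sinL2 T k) (cosL2 T k) = 0 := by rw [real_inner_comm]; exact hcs
  rw [nonlinOp_eq hT, map_add, linOp_coordMap]
  simp only [inner_add_left, inner_smul_left, hcc, hss, hcs, hsc, conj_trivial, h1, h2]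
  constructor <;> ring

/-- The binomial expansion of (x₁ φ_k + x₂ ϕ_k)³ under the integral; a general test function e
serves both components. -/
lemma inner_trilin_coordMap (hT : 0 < T) (x : ℝ × ℝ) {e : ℝ → ℝ} (he : Continuous e) :
    inner ℝ (trilin hT a (coordMap T k x : H2 T) (coordMap T k x) (coordMap T k x))
        (ofCont T e he) =
      pairing a (fun t => cosMode T k t ^ 3) e * x.1 ^ 3 +
      3 * pairing a (fun t => cosMode T k t ^ 2 * sinMode T k t) e * x.1 ^ 2 * x.2 +
      3 * pairing a (fun t => cosMode T k t * sinMode T k t ^ 2) e * x.1 * x.2 ^ 2 +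
      pairing a (fun t => sinMode T k t ^ 3) e * x.2 ^ 3 := by
  have hc := continuous_cosMode T k
  have hs := continuous_sinMode T k
  have ha : IntervalIntegrable a volume 0 T := by
    rw [intervalIntegrable_iff_integrableOn_Ioc_of_le hT.le]
    exact (Lp.memLp a).integrable le_top
  have hint : ∀ {f : ℝ → ℝ}, Continuous f →
      IntervalIntegrable (fun t => a t * f t * e t) volume 0 T := fun hf =>
    (ha.mul_continuousOn hf.continuousOn).mul_continuousOn he.continuousOn
  have h0 : deriv2 T 0 (coordMap T k x : H2 T) =ᵐ[mu T]
      fun t => x.1 * cosMode T k t + x.2 * sinMode T k t := by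
    rw [deriv2_coordMap]
    filter_upwards [Lp.coeFn_add (x.1 • cosL2 T k) (x.2 • sinL2 T k),
      Lp.coeFn_smul x.1 (cosL2 T k), Lp.coeFn_smul x.2 (sinL2 T k), coeFn_ofCont T hc,
      coeFn_ofCont T hs] with t h1 h2 h3 h4 h5
    rw [h1, Pi.add_apply, h2, h3, Pi.smul_apply, Pi.smul_apply, cosL2, sinL2, h4, h5]
    rfl
  rw [inner_ofCont_right hT.le]
  refine Eq.trans ?_ (show x.1 ^ 3 * pairing a (fun t => cosMode T k t ^ 3) e +
      3 * x.1 ^ 2 * x.2 * pairing a (fun t => cosMode T k t ^ 2 * sinMode T k t) e +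
      3 * x.1 * x.2 ^ 2 * pairing a (fun t => cosMode T k t * sinMode T k t ^ 2) e +
      x.2 ^ 3 * pairing a (fun t => sinMode T k t ^ 3) e = _ by ring)
  simp only [pairing]
  rw [← intervalIntegral.integral_const_mul, ← intervalIntegral.integral_const_mul,
    ← intervalIntegral.integral_const_mul, ← intervalIntegral.integral_const_mul,
    ← intervalIntegral.integral_add, ← intervalIntegral.integral_add,
    ← intervalIntegral.integral_add]
  · refine intervalIntegral_congr_mu hT.le ?_
    filter_upwards [h0, coeFn_trilin hT a (coordMap T k x : H2 T) (coordMap T k x)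
      (coordMap T k x)] with t h1 h2
    rw [h2, h1]
    ring
  all_goals
    repeat' apply IntervalIntegrable.add
    all_goals exact (hint (by fun_prop)).const_mul _

lemma h1_eq (hT : 0 < T) (hk : 1 ≤ k) (p : ℝ × ℝ × ℝ) :
    h1 a k ψ p = inner ℝ (nonlinOp a p.1
      ((coordMap T k p.2 : H2 T) + (ψ (p.1, coordMap T k p.2) : H2 T))) (cosL2 T k) :=
  (inner_projQ hT hk _).1

lemma h2_eq (hT : 0 < T) (hk : 1 ≤ k) (p : ℝ × ℝ × ℝ) :
    h2 a k ψ p = inner ℝ (nonlinOp a p.1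
      ((coordMap T k p.2 : H2 T) + (ψ (p.1, coordMap T k p.2) : H2 T))) (sinL2 T k) :=
  (inner_projQ hT hk _).2

lemma contDiff_coordMap (T : ℝ) (k : ℕ) :
    ContDiff ℝ ∞ fun p : ℝ × ℝ × ℝ => (coordMap T k p.2 : H2 T) := by
  have : ContDiff ℝ ∞ fun p : ℝ × ℝ × ℝ => p.2.1 • cosH2 T k + p.2.2 • sinH2 T k := by fun_prop
  exact this

lemma IsReduction.contDiffOn_sum (h : IsReduction a k I N ψ) :
    ContDiffOn ℝ ∞ (fun p : ℝ × ℝ × ℝ =>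
      (coordMap T k p.2 : H2 T) + (ψ (p.1, coordMap T k p.2) : H2 T))
      (I ×ˢ (coordMap T k ⁻¹' N)) :=
  (contDiff_coordMap T k).contDiffOn.add h.contDiffOn_comp

lemma IsReduction.contDiffOn_nonlinOp (hT : 0 < T) (h : IsReduction a k I N ψ) :
    ContDiffOn ℝ ∞ (fun p : ℝ × ℝ × ℝ => nonlinOp a p.1
      ((coordMap T k p.2 : H2 T) + (ψ (p.1, coordMap T k p.2) : H2 T)))
      (I ×ˢ (coordMap T k ⁻¹' N)) :=
  contDiffOn_comp_fst_prod (contDiff_nonlinOp hT a) h.contDiffOn_sum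

lemma isBigO_sum_of_le {R : ℝ × ℝ × ℝ → ℝ} {σ C : ℝ}
    (hR : ∀ᶠ p in 𝓝 (σ, (0 : ℝ × ℝ)), |R p| ≤ C * ‖p.2‖ ^ 4)
    (nrm : Seminorm ℝ (ℝ × ℝ)) (hn : ∀ x, nrm x = 0 → x = 0) :
    R =O[𝓝 (σ, 0, 0)] fun p => ∑ j ∈ Finset.range 5, |p.1 - σ| ^ j * nrm p.2 ^ (4 - j) := by
  obtain ⟨B, hB, hb⟩ := exists_norm_le_of_definite nrm hn
  refine IsBigO.of_bound (|C| * B ^ 4) ?_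
  filter_upwards [hR] with p hp
  have hterm : ∀ j ∈ Finset.range 5, 0 ≤ |p.1 - σ| ^ j * nrm p.2 ^ (4 - j) := fun j _ =>
    mul_nonneg (pow_nonneg (abs_nonneg _) _) (pow_nonneg (apply_nonneg _ _) _)
  -- Only the j = 0 term is used; the others are nonnegative.
  have h4 : nrm p.2 ^ 4 ≤ ∑ j ∈ Finset.range 5, |p.1 - σ| ^ j * nrm p.2 ^ (4 - j) := by
    simpa using Finset.single_le_sum hterm (Finset.mem_range.2 (by norm_num : 0 < 5))
  rw [Real.norm_eq_abs, Real.norm_of_nonneg (Finset.sum_nonneg hterm)]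
  calc |R p| ≤ C * ‖p.2‖ ^ 4 := hp
    _ ≤ |C| * (B * nrm p.2) ^ 4 := by
      gcongr
      · exact le_abs_self C
      · exact hb p.2
    _ = |C| * B ^ 4 * nrm p.2 ^ 4 := by ring
    _ ≤ _ := by gcongr

end Bounds

end Expansion

lemma IsReduction.exists_expansion {T : ℝ} {k : ℕ} {a : Lp ℝ ⊤ (mu T)} {I : Set ℝ}
    {N : Set (kernel T k)} {ψ : ℝ × kernel T k → (kernel T k)ᗮ} (hT : 0 < T) (hk : 1 ≤ k)
    (h : IsReduction a k I N ψ) {e : ℝ → ℝ} (he : Continuous e) :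
    ∃ C, ∀ᶠ p : ℝ × ℝ × ℝ in 𝓝 (sigma T k, (0 : ℝ × ℝ)), ∀ u : H2 T,
      u = coordMap T k p.2 + ψ (p.1, coordMap T k p.2) →
      |inner ℝ (trilin hT a u u u) (ofCont T e he) -
        (pairing a (fun t => cosMode T k t ^ 3) e * p.2.1 ^ 3 +
        3 * pairing a (fun t => cosMode T k t ^ 2 * sinMode T k t) e * p.2.1 ^ 2 * p.2.2 +
        3 * pairing a (fun t => cosMode T k t * sinMode T k t ^ 2) e * p.2.1 * p.2.2 ^ 2 +
        pairing a (fun t => sinMode T k t ^ 3) e * p.2.2 ^ 3)| ≤ C * ‖p.2‖ ^ 4 := by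
  obtain ⟨C, hC⟩ := h.exists_trilin_sub_le hT hk
  refine ⟨C * ‖ofCont T e he‖, ?_⟩
  filter_upwards [hC] with p hp u hu
  rw [← inner_trilin_coordMap hT p.2 he, ← inner_sub_left]
  refine (abs_real_inner_le_norm _ _).trans ?_
  refine (mul_le_mul_of_nonneg_right (hp u _ rfl hu) (norm_nonneg _)).trans (le_of_eq ?_)
  ring

lemma pairing_eq_of_mul_eq {T : ℝ} {a : Lp ℝ ⊤ (mu T)} {f g f' g' : ℝ → ℝ}
    (h : ∀ t, f t * g t = f' t * g' t) : pairing a f g = pairing a f' g' := by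
  simp only [pairing, mul_assoc, h]

end PeriodicReduction

end

theorem theorem3p14 (T : ℝ) (hT : 0 < T) (a : Lp ℝ ⊤ (mu T)) (ha : 0 ≤ a) (ha0 : a ≠ 0)
    (k : ℕ) (hk : 1 ≤ k) :
    -- the reduction exists, and near `(σ_k, 0)` it captures all solutions of the auxiliary equation
    (∃ (I : Set ℝ) (N : Set (kernel T k)) (ψ : ℝ × kernel T k → (kernel T k)ᗮ),
      IsReduction a k I N ψ ∧
      ∃ O ∈ 𝓝 ((sigma T k, 0) : ℝ × H2 T), ∀ (lam : ℝ) (x : kernel T k) (y : (kernel T k)ᗮ),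
        (lam, (x : H2 T) + (y : H2 T)) ∈ O → auxMap a k lam x y = 0 →
          lam ∈ I ∧ x ∈ N ∧ y = ψ (lam, x)) ∧
    -- the alternative expressions of the mixed coefficients
    coeffB a k = pairing a (fun t => cosMode T k t ^ 3) (sinMode T k) ∧
    coeffC a k = pairing a (fun t => cosMode T k t ^ 2 * sinMode T k t) (sinMode T k) ∧
    coeffD a k = pairing a (fun t => cosMode T k t * sinMode T k t ^ 2) (sinMode T k) ∧
    -- the expansion of the reduced map
    ∀ (I : Set ℝ) (N : Set (kernel T k)) (ψ : ℝ × kernel T k → (kernel T k)ᗮ),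
      IsReduction a k I N ψ →
        ContDiffOn ℝ ∞ (h1 a k ψ) (I ×ˢ (coordMap T k ⁻¹' N)) ∧
        ContDiffOn ℝ ∞ (h2 a k ψ) (I ×ˢ (coordMap T k ⁻¹' N)) ∧
        ∃ R₁ R₂ : ℝ × ℝ × ℝ → ℝ,
          (∀ lam ∈ I, ∀ x₁ x₂ : ℝ, coordMap T k (x₁, x₂) ∈ N →
            h1 a k ψ (lam, x₁, x₂) =
              (lam - sigma T k) * x₁ + coeffA a k * x₁ ^ 3 + 3 * coeffB a k * x₁ ^ 2 * x₂
                + 3 * coeffC a k * x₁ * x₂ ^ 2 + coeffD a k * x₂ ^ 3 + R₁ (lam, x₁, x₂) ∧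
            h2 a k ψ (lam, x₁, x₂) =
              (lam - sigma T k) * x₂ + coeffB a k * x₁ ^ 3 + 3 * coeffC a k * x₁ ^ 2 * x₂
                + 3 * coeffD a k * x₁ * x₂ ^ 2 + coeffE a k * x₂ ^ 3 + R₂ (lam, x₁, x₂)) ∧
          -- `nrm` is an arbitrary norm on `ℝ²`
          ∀ nrm : Seminorm ℝ (ℝ × ℝ), (∀ x, nrm x = 0 → x = 0) →
            (R₁ =O[𝓝 (sigma T k, 0, 0)] fun p =>
              ∑ j ∈ Finset.range 5, |p.1 - sigma T k| ^ j * nrm p.2 ^ (4 - j)) ∧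
            (R₂ =O[𝓝 (sigma T k, 0, 0)] fun p =>
              ∑ j ∈ Finset.range 5, |p.1 - sigma T k| ^ j * nrm p.2 ^ (4 - j)) := by
  have hB : coeffB a k = pairing a (fun t => cosMode T k t ^ 3) (sinMode T k) :=
    pairing_eq_of_mul_eq fun t => by ring
  have hC : coeffC a k = pairing a (fun t => cosMode T k t ^ 2 * sinMode T k t) (sinMode T k) :=
    pairing_eq_of_mul_eq fun t => by ring
  have hD : coeffD a k = pairing a (fun t => cosMode T k t * sinMode T k t ^ 2) (sinMode T k) :=
    pairing_eq_of_mul_eq fun t => by ring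
  refine ⟨exists_isReduction hT hk a, hB, hC, hD, fun I N ψ h => ⟨?_, ?_, ?_⟩⟩
  · exact ((h.contDiffOn_nonlinOp hT).inner ℝ (contDiffOn_const (c := cosL2 T k))).congr
      fun p _ => h1_eq hT hk p
  · exact ((h.contDiffOn_nonlinOp hT).inner ℝ (contDiffOn_const (c := sinL2 T k))).congr
      fun p _ => h2_eq hT hk p
  -- The remainders are defined as the differences, so the two identities are automatic and only the
  -- growth estimates have content.
  refine ⟨fun p => h1 a k ψ p - ((p.1 - sigma T k) * p.2.1 + (coeffA a k * p.2.1 ^ 3 +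
      3 * coeffB a k * p.2.1 ^ 2 * p.2.2 + 3 * coeffC a k * p.2.1 * p.2.2 ^ 2 +
      coeffD a k * p.2.2 ^ 3)),
    fun p => h2 a k ψ p - ((p.1 - sigma T k) * p.2.2 + (coeffB a k * p.2.1 ^ 3 +
      3 * coeffC a k * p.2.1 ^ 2 * p.2.2 + 3 * coeffD a k * p.2.1 * p.2.2 ^ 2 +
      coeffE a k * p.2.2 ^ 3)),
    fun lam _ x₁ x₂ _ => ⟨by ring, by ring⟩, fun nrm hn => ⟨?_, ?_⟩⟩
  · obtain ⟨C, hbound⟩ := h.exists_expansion hT hk (continuous_cosMode T k)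
    refine isBigO_sum_of_le (C := C) ?_ nrm hn
    filter_upwards [hbound] with p hp
    rw [h1_eq hT hk, (inner_nonlinOp_modes hT hk p.1 p.2 (ψ _).2).1, add_sub_add_left_eq_sub]
    exact hp _ rfl
  · obtain ⟨C, hbound⟩ := h.exists_expansion hT hk (continuous_sinMode T k)
    refine isBigO_sum_of_le (C := C) ?_ nrm hn
    filter_upwards [hbound] with p hp
    -- Testing against ϕ_k produces the alternative expressions of b_k, c_k and d_k, hence the
    -- rewriting by `hB`, `hC`, `hD`.
    rw [h2_eq hT hk, (inner_nonlinOp_modes hT hk p.1 p.2 (ψ _).2).2, add_sub_add_left_eq_sub,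
      hB, hC, hD]
    exact hp _ rfl
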